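/- Let $K$ be a field with $\operatorname{char}K\neq 2$, let $Q$ be a locally finite quiver, and let $\rho$ be a set of paths of length at least $2$ in $Q$ such that for each vertex $i$ all sufficiently long paths starting or ending at $i$ lie in the ideal $\langle\rho\rangle$, i.e. have a subpath in $\rho$. Modules over the zero-relation algebra $\Lambda=KQ/\langle\rho\rangle$ are identified with $K$-representations of $Q$ on which the paths in $\rho$ act as zero. A *tree* is a finite quiver whose underlying undirected graph is a tree. A *bound quiver morphism* $F:T\to(Q,\rho)$ is a quiver morphism $F:T\to Q$ such that $F(p)\notin\langle\rho\rangle$ for every path $p$ in $T$. For a tree $T$ and such an $F$, the *generalised tree module* $F_\lambda(V_T)$ has the space $\bigoplus_{F(n)=i}K$ at the vertex $i$ of $Q$, hence a canonical basis $(v_n)_{n\in T_0}$, and an arrow $\gamma$ of $Q$ acts by $\gamma\cdot v_n=\sum_{a:n\to n',\,F(a)=\gamma}v_{n'}$. Let $T^1,T^2$ be trees, $F_k:T^k\to(Q,\rho)$ bound quiver morphisms and $M_k=F_{k\lambda}(V_{T^k})$ ($k=1,2$), with canonical bases $(v_n)_{n\in T^1_0}$ and $(w_m)_{m\in T^2_0}$.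 *Networks.* A network is a quiver together with a simple undirected graph on the same vertex set; its links are its arrows, the formal inverses of its arrows, and its edges, and a traversal is a sequence of consecutive links in which no link is followed by its inverse. The *pullback network* $\mathcal N[1]$ has the vertices $(n,m)\in T^1_0\times T^2_0$ with $F_1(n)=F_2(m)$; the arrows $(a,b):(n,m)\to(n',m')$ for arrows $a:n\to n'$ of $T^1$ and $b:m\to m'$ of $T^2$ with $F_1(a)=F_2(b)$; and the edges $\{(n,m),(n',m)\}$ for which $n\ne n'$ and there are arrows $n\xleftarrow{a}n''\xrightarrow{c}n'$ in $T^1$ with $F_1(a)=F_1(c)$, and $\{(n,m),(n,m')\}$ for which $m\neq m'$ and there are arrows $m\xrightarrow{b}m''\xleftarrow{d}m'$ in $T^2$ with $F_2(b)=F_2(d)$. The *2-covering network* $\mathcal N[2]$ has the vertices $(n,m,j)$ with $(n,m)\in\mathcal N[1]_0$, $j\in\{-1,1\}$, the arrows $(a,b,j):(n,m,j)\to(n',m',j)$ for arrows $(a,b):(n,m)\to(n',m')$ of $\mathcal N[1]$, and the edges $\{(n,m,j),(n',m',-j)\}$ for edges $\{(n,m),(n',m')\}$ of $\mathcal N[1]$.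 Let $\pi:\mathcal N[2]\to\mathcal N[1]$ be the projection. Let $\mathcal R[1]$ be the set of traversals $x - y - z$ of length $2$ in $\mathcal N[1]$ such that $x,y,z$ are distinct and pairwise linked, and let $\mathcal R[2]$ be the set of traversals of $\mathcal N[2]$ whose image under $\pi$ lies in $\mathcal R[1]$. A subnetwork $\mathcal M$ of $\mathcal N[2]$ with vertex set $\mathcal M_0$ is - *$\mathcal R[2]$-free* if no traversal of $\mathcal M$ lies in $\mathcal R[2]$; - *connected* if its underlying undirected graph is connected; - *involution-free* if $(n,m,j)\in\mathcal M_0$ implies $(n,m,-j)\notin\mathcal M_0$, and *involution-invariant* if $\mathcal M_0=\pi^{-1}(\pi(\mathcal M_0))$; - *complete* if for every $(n,m,j)\in\mathcal M_0$: (1) for each arrow $a:n'\to n$ of $T^1$, either $\mathcal M$ contains an arrow $(a,b,j):(n',m',j)\to(n,m,j)$, or there is an arrow $c:n'\to n''$ of $T^1$ with $F_1(c)=F_1(a)$ such that $\{(n,m,j),(n'',m,-j)\}$ is an edge of $\mathcal M$; and (2) for each arrow $b:m\to m'$ of $T^2$, either $\mathcal M$ contains an arrow $(a,b,j):(n,m,j)\to(n',m',j)$,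 or there is an arrow $d:m''\to m'$ of $T^2$ with $F_2(d)=F_2(b)$ such that $\{(n,m,j),(n,m'',-j)\}$ is an edge of $\mathcal M$. A *generalised graph map* from $M_1$ to $M_2$ is a non-empty, connected, involution-free, complete, $\mathcal R[2]$-free subnetwork $\mathcal G$ of $\mathcal N[2]$; it defines the $K$-linear map $\mathcal H_{\mathcal G}:M_1\to M_2$, $\mathcal H_{\mathcal G}(v_n)=\sum_{(n,m,j)\in\mathcal G_0}j\,w_m$. A *ghost* is a non-empty, connected, involution-invariant, complete, $\mathcal R[2]$-free subnetwork of $\mathcal N[2]$, and the pair $(M_1,M_2)$ is *ghost-free* if $\mathcal N[2]$ contains no ghost. **Theorem.** Suppose that $(M_1,M_2)$ is ghost-free. Then $\mathcal H_{\mathcal G}$ is a homomorphism of $\Lambda$-modules for every generalised graph map $\mathcal G$ from $M_1$ to $M_2$, and for every homomorphism $\mathcal H:M_1\to M_2$ there exist $N\ge0$, $\mu_1,\dots,\mu_N\in K$ and generalised graph maps $\mathcal G_1,\dots,\mathcal G_N$ from $M_1$ to $M_2$ such that $$\mathcal H=\sum_{l=1}^N\mu_l\,\mathcal H_{\mathcal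 G_l}.$$ -/

import Mathlib

open scoped DirectSum

namespace GTM

universe u v w

/-! ### Bound quivers -/

section BoundQuiver

variable {Q : Type*} [Quiver Q]

/-- A path lies in the two-sided ideal `⟨ρ⟩` of the path algebra generated by the set `ρ` of paths,
i.e. it has a subpath in `ρ`. -/
def InIdeal (ρ : ∀ i j : Q, Set (Quiver.Path i j)) {i j : Q} (p : Quiver.Path i j) : Prop :=
  ∃ (k l : Q) (x : Quiver.Path i k) (r : Quiver.Path k l) (y : Quiver.Path l j),
    r ∈ ρ k l ∧ p = (x.comp r).comp y

/-- `(Q, ρ)` is a locally bound quiver: `Q` is locally finite, `ρ` consists of paths of length at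
least two, and for each vertex `i` all sufficiently long paths starting or ending at `i` lie in
`⟨ρ⟩`. -/
structure IsLocallyBound (ρ : ∀ i j : Q, Set (Quiver.Path i j)) : Prop where
  finite_out : ∀ i : Q, Finite (Quiver.Star i)
  finite_in : ∀ i : Q, Finite (Quiver.Costar i)
  two_le_length : ∀ (i j : Q), ∀ p ∈ ρ i j, 2 ≤ p.length
  long_paths : ∀ i : Q, ∃ N : ℕ,
    (∀ (j : Q) (p : Quiver.Path i j), N < p.length → InIdeal ρ p) ∧
    (∀ (j : Q) (p : Quiver.Path j i), N < p.length → InIdeal ρ p)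

end BoundQuiver

/-! ### Representations, i.e. modules over `KQ/⟨ρ⟩` -/

/-- A `K`-representation of a quiver. -/
structure Rep (K : Type*) [Field K] (Q : Type*) [Quiver Q] where
  obj : Q → Type w
  [addCommGroup : ∀ i, AddCommGroup (obj i)]
  [module : ∀ i, Module K (obj i)]
  map : ∀ {i j : Q}, (i ⟶ j) → (obj i →ₗ[K] obj j)

attribute [instance] Rep.addCommGroup Rep.module

/-- The action of a path on a representation. -/
def Rep.pathMap {K : Type*} [Field K] {Q : Type*} [Quiver Q] (M : Rep.{w} K Q) {i : Q} :
    ∀ {j : Q}, Quiver.Path i j → (M.obj i →ₗ[K] M.obj j)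
  | _, Quiver.Path.nil => LinearMap.id
  | _, Quiver.Path.cons p γ => (M.map γ).comp (M.pathMap p)

/-- A module over the zero-relation algebra `KQ/⟨ρ⟩`: a representation of `Q` on which every path
in `ρ` acts as zero. -/
structure BoundRep (K : Type*) [Field K] {Q : Type*} [Quiver Q]
    (ρ : ∀ i j : Q, Set (Quiver.Path i j)) extends Rep.{w} K Q where
  relations : ∀ (i j : Q), ∀ p ∈ ρ i j, toRep.pathMap p = 0

/-- The `K`-space of module homomorphisms `M → N`: families of linear maps commuting with the
action of all arrows. -/
def HomSpace {K : Type*} [Field K] {Q : Type*} [Quiver Q]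
    {ρ : ∀ i j : Q, Set (Quiver.Path i j)} (M : BoundRep.{v} K ρ) (N : BoundRep.{w} K ρ) :
    Submodule K (∀ i : Q, M.obj i →ₗ[K] N.obj i) where
  carrier := {f | ∀ (i j : Q) (γ : i ⟶ j) (x : M.obj i), f j (M.map γ x) = N.map γ (f i x)}
  zero_mem' := by intro i j γ x; simp
  add_mem' := by intro f g hf hg i j γ x; simp [hf i j γ x, hg i j γ x]
  smul_mem' := by intro c f hf i j γ x; simp [hf i j γ x]

/-! ### Trees and generalised tree modules -/

/-- A tree: a finite quiver whose underlying undirected (multi)graph is a tree, i.e. it has no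
loops, no two arrows with the same pair of endpoints, and is connected and acyclic. -/
class IsTreeQuiver (T : Type*) [Quiver T] : Prop where
  finite_vertices : Finite T
  finite_arrows : Finite (Quiver.Total T)
  no_loop : ∀ a : Quiver.Total T, a.left ≠ a.right
  no_multiple : ∀ a b : Quiver.Total T, s(a.left, a.right) = s(b.left, b.right) → a = b
  isTree : (SimpleGraph.fromRel fun n m : T => Nonempty (n ⟶ m)).IsTree

attribute [instance] IsTreeQuiver.finite_vertices IsTreeQuiver.finite_arrows

/-- The action of a quiver morphism on the set of all arrows. -/
def arrowMap {T Q : Type*} [Quiver T] [Quiver Q] (F : T ⥤q Q) (a : Quiver.Total T) :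
    Quiver.Total Q :=
  ⟨F.obj a.left, F.obj a.right, F.map a.hom⟩

theorem obj_left_of_arrowMap {T Q : Type*} [Quiver T] [Quiver Q] {F : T ⥤q Q}
    {a : Quiver.Total T} {b : Quiver.Total Q} (h : arrowMap F a = b) : F.obj a.left = b.left :=
  congrArg Quiver.Total.left h

theorem obj_right_of_arrowMap {T Q : Type*} [Quiver T] [Quiver Q] {F : T ⥤q Q}
    {a : Quiver.Total T} {b : Quiver.Total Q} (h : arrowMap F a = b) : F.obj a.right = b.right :=
  congrArg Quiver.Total.right h

/-- `F : T → (Q, ρ)` is a bound quiver morphism: no path of `T` is mapped into `⟨ρ⟩`. -/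
def IsBoundMorphism {T Q : Type*} [Quiver T] [Quiver Q]
    (ρ : ∀ i j : Q, Set (Quiver.Path i j)) (F : T ⥤q Q) : Prop :=
  ∀ (n m : T) (p : Quiver.Path n m), ¬ InIdeal ρ (F.mapPath p)

section PushDown

variable {K : Type*} [Field K] {T Q : Type*} [Quiver T] [Quiver Q]

open Classical in
/-- The action `∑_{a ∈ F⁻¹(γ)} U_a` of an arrow `γ : i ⟶ j` of `Q` on the push-down of a
representation `U` of a tree along `F`. -/
noncomputable def pushDownMap [IsTreeQuiver T] (F : T ⥤q Q) (U : Rep.{w} K T) {i j : Q}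
    (γ : i ⟶ j) :
    (⨁ n : {n : T // F.obj n = i}, U.obj n) →ₗ[K] ⨁ n : {n : T // F.obj n = j}, U.obj n :=
  ∑ᶠ a : {a : Quiver.Total T // arrowMap F a = ⟨i, j, γ⟩},
    (DirectSum.lof K {n : T // F.obj n = j} (fun n => U.obj n)
        ⟨a.1.right, obj_right_of_arrowMap a.2⟩).comp
      ((U.map a.1.hom).comp
        (DirectSum.component K {n : T // F.obj n = i} (fun n => U.obj n)
          ⟨a.1.left, obj_left_of_arrowMap a.2⟩))

/-- The push-down `F_λ U` of a representation `U` of a tree along `F`: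
`(F_λ U)_i = ⨁_{n ∈ F⁻¹(i)} U_n` and `(F_λ U)_γ = ∑_{a ∈ F⁻¹(γ)} U_a`. -/
noncomputable abbrev pushDown [IsTreeQuiver T] (F : T ⥤q Q) (U : Rep.{w} K T) : Rep K Q where
  obj i := ⨁ n : {n : T // F.obj n = i}, U.obj n
  map γ := pushDownMap F U γ

variable (K T) in
/-- The representation `V_T` of `T` with `K` at each vertex and the identity at each arrow. -/
abbrev constRep : Rep K T where
  obj _ := K
  map _ := LinearMap.id

open Classical in
theorem pushDownMap_lof_mem [IsTreeQuiver T] (F : T ⥤q Q) (U : Rep.{w} K T) {i j : Q} (γ : i ⟶ j)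
    (S : Submodule K (⨁ n : {n : T // F.obj n = j}, U.obj n)) (m : T) (hm : F.obj m = i)
    (y : U.obj m)
    (h : ∀ (m' : T) (a : m ⟶ m') (ha : arrowMap F ⟨m, m', a⟩ = ⟨i, j, γ⟩) (z : U.obj m'),
      DirectSum.lof K {n : T // F.obj n = j} (fun n => U.obj n)
        ⟨m', obj_right_of_arrowMap ha⟩ z ∈ S) :
    pushDownMap F U γ
      (DirectSum.lof K {n : T // F.obj n = i} (fun n => U.obj n) ⟨m, hm⟩ y) ∈ S := by
  have := Fintype.ofFinite {a : Quiver.Total T // arrowMap F a = ⟨i, j, γ⟩}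
  rw [pushDownMap, finsum_eq_sum_of_fintype, LinearMap.sum_apply]
  refine Submodule.sum_mem _ ?_
  rintro ⟨⟨a₁, a₂, a⟩, ha⟩ -
  by_cases h' : a₁ = m
  · subst h'
    exact h _ a ha _
  · have h0 : DirectSum.component K {n : T // F.obj n = i} (fun n => U.obj n)
        ⟨a₁, obj_left_of_arrowMap ha⟩
        (DirectSum.lof K {n : T // F.obj n = i} (fun n => U.obj n) ⟨m, hm⟩ y) = 0 := by
      rw [DirectSum.component.of, dif_neg]
      intro h''
      exact h' (congrArg Subtype.val h'').symm
    rw [LinearMap.comp_apply, LinearMap.comp_apply, h0, map_zero, map_zero]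
    exact Submodule.zero_mem _

open Classical in
theorem pushDown_pathMap_mem_span [IsTreeQuiver T] (F : T ⥤q Q) (U : Rep.{w} K T)
    {i j : Q} (q : Quiver.Path i j) (n : T) (hn : F.obj n = i) (u : U.obj n) :
    (pushDown F U).pathMap q
      (DirectSum.lof K {n : T // F.obj n = i} (fun n => U.obj n) ⟨n, hn⟩ u) ∈
      Submodule.span K {x : (pushDown F U).obj j | ∃ (m : T) (hm : F.obj m = j) (y : U.obj m)
        (p : Quiver.Path n m), F.mapPath p ≍ q ∧
          x = DirectSum.lof K {n : T // F.obj n = j} (fun n => U.obj n) ⟨m, hm⟩ y} := by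
  induction q with
  | nil =>
    subst hn
    exact Submodule.subset_span ⟨n, rfl, u, Quiver.Path.nil, HEq.rfl, rfl⟩
  | @cons k l q γ ih =>
    have key : ∀ x ∈ {x : (pushDown F U).obj k | ∃ (m : T) (hm : F.obj m = k) (y : U.obj m)
        (p : Quiver.Path n m), F.mapPath p ≍ q ∧
          x = DirectSum.lof K {n : T // F.obj n = k} (fun n => U.obj n) ⟨m, hm⟩ y},
        (pushDown F U).map γ x ∈
          Submodule.span K {x : (pushDown F U).obj l | ∃ (m : T) (hm : F.obj m = l) (y : U.obj m)
            (p : Quiver.Path n m), F.mapPath p ≍ q.cons γ ∧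
            x = DirectSum.lof K {n : T // F.obj n = l} (fun n => U.obj n) ⟨m, hm⟩ y} := by
      rintro x ⟨m, hm, y, p, hp, rfl⟩
      refine pushDownMap_lof_mem F U γ (Submodule.span K
        {x : ⨁ n : {n : T // F.obj n = l}, U.obj n | ∃ (m : T) (hm : F.obj m = l) (y : U.obj m)
            (p : Quiver.Path n m), F.mapPath p ≍ q.cons γ ∧
            x = DirectSum.lof K {n : T // F.obj n = l} (fun n => U.obj n) ⟨m, hm⟩ y})
        m hm y fun m' a ha z => ?_
      refine Submodule.subset_span ⟨m', obj_right_of_arrowMap ha, z, p.cons a, ?_, rfl⟩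
      subst hn
      simp only [arrowMap, Quiver.Total.mk.injEq] at ha
      obtain ⟨h1, h2, h3⟩ := ha
      subst h1 h2
      obtain rfl := eq_of_heq h3
      obtain rfl := eq_of_heq hp
      exact HEq.rfl
    have := Submodule.mem_map_of_mem (f := (pushDown F U).map γ) ih
    refine (Submodule.map_span_le _ _ _).2 key this

theorem pushDown_relations [IsTreeQuiver T] (F : T ⥤q Q) (U : Rep.{w} K T)
    (ρ : ∀ i j : Q, Set (Quiver.Path i j)) (hF : IsBoundMorphism ρ F)
    (i j : Q) (q : Quiver.Path i j) (hq : q ∈ ρ i j) : (pushDown F U).pathMap q = 0 := by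
  classical
  refine DirectSum.linearMap_ext _ fun n => LinearMap.ext fun u => ?_
  obtain ⟨n, hn⟩ := n
  have h := pushDown_pathMap_mem_span F U q n hn u
  have hempty : {x : (pushDown F U).obj j | ∃ (m : T) (hm : F.obj m = j) (y : U.obj m)
        (p : Quiver.Path n m), F.mapPath p ≍ q ∧
          x = DirectSum.lof K {n : T // F.obj n = j} (fun n => U.obj n) ⟨m, hm⟩ y} = ∅ := by
    refine Set.eq_empty_iff_forall_notMem.2 ?_
    rintro x ⟨m, hm, y, p, hp, -⟩
    subst hn hm
    obtain rfl := eq_of_heq hp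
    exact hF n m p ⟨_, _, Quiver.Path.nil, F.mapPath p, Quiver.Path.nil, hq, by simp⟩
  rw [hempty, Submodule.span_empty, Submodule.mem_bot] at h
  exact h

variable (K) in
/-- The generalised tree module `F_λ(V_T)`. -/
noncomputable abbrev genTreeModule [IsTreeQuiver T] (ρ : ∀ i j : Q, Set (Quiver.Path i j))
    (F : T ⥤q Q) (hF : IsBoundMorphism ρ F) : BoundRep K ρ where
  toRep := pushDown F (constRep K T)
  relations := pushDown_relations F (constRep K T) ρ hF

variable (K) in
open Classical in
/-- The canonical basis vector `v_n` of `F_λ(V_T)`, in the component at `i = F(n)`. -/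
noncomputable def basisVec [IsTreeQuiver T] (ρ : ∀ i j : Q, Set (Quiver.Path i j))
    (F : T ⥤q Q) (hF : IsBoundMorphism ρ F) {i : Q} (n : {n : T // F.obj n = i}) :
    (genTreeModule K ρ F hF).obj i :=
  DirectSum.lof K {n : T // F.obj n = i} (fun _ => K) n 1

end PushDown

/-! ### Networks, subnetworks and traversals -/

/-- A network: a quiver together with a simple undirected graph on the same vertex set. -/
structure Network where
  V : Type u
  A : Type v
  src : A → V
  tgt : A → V
  E : SimpleGraph V

/-- A link of a network: an arrow, a formal inverse of an arrow, or an (oriented) edge. -/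
inductive Network.Link (N : Network.{u, v}) : Type (max u v)
  | arrow (a : N.A)
  | inv (a : N.A)
  | edge (x y : N.V) (h : N.E.Adj x y)

namespace Network

variable {N : Network.{u, v}}

/-- The vertex at which a link starts. -/
def Link.start : N.Link → N.V
  | .arrow a => N.src a
  | .inv a => N.tgt a
  | .edge x _ _ => x

/-- The vertex at which a link ends. -/
def Link.finish : N.Link → N.V
  | .arrow a => N.tgt a
  | .inv a => N.src a
  | .edge _ y _ => y

/-- The inverse of a link. -/
def Link.reverse : N.Link → N.Link
  | .arrow a => .inv a
  | .inv a => .arrow a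
  | .edge x y h => .edge y x h.symm

/-- A traversal: a sequence of links `[α₁, …, αₙ]`, each starting where the previous one ends, that
never follows a link by its inverse. -/
def IsTraversal (t : List N.Link) : Prop :=
  t.IsChain fun α β => α.finish = β.start ∧ β ≠ α.reverse

/-- There is a link from `x` to `y`. -/
def Linked (N : Network.{u, v}) (x y : N.V) : Prop :=
  ∃ α : N.Link, α.start = x ∧ α.finish = y

/-- The subnetwork induced by `{x, y, z}` is a triangle: `x, y, z` are three vertices, any two of
which are linked. -/
def IsTriangle (N : Network.{u, v}) (x y z : N.V) : Prop :=
  x ≠ y ∧ y ≠ z ∧ x ≠ z ∧ N.Linked x y ∧ N.Linked y z ∧ N.Linked x z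

/-- A subnetwork of a network. -/
structure Subnetwork (N : Network.{u, v}) where
  verts : Set N.V
  arrows : Set N.A
  edges : Set (Sym2 N.V)
  src_mem : ∀ a ∈ arrows, N.src a ∈ verts
  tgt_mem : ∀ a ∈ arrows, N.tgt a ∈ verts
  edges_subset : edges ⊆ N.E.edgeSet
  edge_mem : ∀ e ∈ edges, ∀ x ∈ e, x ∈ verts

namespace Subnetwork

/-- A link of `N` belongs to the subnetwork `M`. -/
def HasLink (M : N.Subnetwork) : N.Link → Prop
  | .arrow a => a ∈ M.arrows
  | .inv a => a ∈ M.arrows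
  | .edge x y _ => s(x, y) ∈ M.edges

/-- A traversal of the subnetwork `M`. -/
def IsTraversal (M : N.Subnetwork) (t : List N.Link) : Prop :=
  Network.IsTraversal t ∧ ∀ α ∈ t, M.HasLink α

/-- The underlying undirected graph of a subnetwork. -/
def graph (M : N.Subnetwork) : SimpleGraph M.verts :=
  SimpleGraph.fromRel fun x y =>
    ∃ α : N.Link, M.HasLink α ∧ α.start = x.1 ∧ α.finish = y.1

/-- A subnetwork is free of a set of traversals if it has no traversal in that set. -/
def IsFreeOf (M : N.Subnetwork) (R : Set (List N.Link)) : Prop :=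
  ∀ t : List N.Link, M.IsTraversal t → t ∉ R

end Subnetwork

end Network

/-! ### The pullback network and the 2-covering network -/

section Networks

variable {T₁ T₂ Q : Type*} [Quiver T₁] [Quiver T₂] [Quiver Q]

/-- The pullback network `N[1]`: the pullback quiver of `F₁` and `F₂` with the sign-flip edges. -/
abbrev pullbackNetwork (F₁ : T₁ ⥤q Q) (F₂ : T₂ ⥤q Q) : Network where
  V := {x : T₁ × T₂ // F₁.obj x.1 = F₂.obj x.2}
  A := {a : Quiver.Total T₁ × Quiver.Total T₂ // arrowMap F₁ a.1 = arrowMap F₂ a.2}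
  src a := ⟨(a.1.1.left, a.1.2.left), obj_left_of_arrowMap a.2⟩
  tgt a := ⟨(a.1.1.right, a.1.2.right), obj_right_of_arrowMap a.2⟩
  E :=
    { Adj := fun x y =>
        (x.1.2 = y.1.2 ∧ x.1.1 ≠ y.1.1 ∧ ∃ a b : Quiver.Total T₁, a.left = b.left ∧
          a.right = x.1.1 ∧ b.right = y.1.1 ∧ arrowMap F₁ a = arrowMap F₁ b) ∨
        (x.1.1 = y.1.1 ∧ x.1.2 ≠ y.1.2 ∧ ∃ c d : Quiver.Total T₂, c.right = d.right ∧
          c.left = x.1.2 ∧ d.left = y.1.2 ∧ arrowMap F₂ c = arrowMap F₂ d)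
      symm := ⟨by
        rintro x y (⟨h, h', a, b, h1, h2, h3, h4⟩ | ⟨h, h', a, b, h1, h2, h3, h4⟩)
        · exact Or.inl ⟨h.symm, h'.symm, b, a, h1.symm, h3, h2, h4.symm⟩
        · exact Or.inr ⟨h.symm, h'.symm, b, a, h1.symm, h3, h2, h4.symm⟩⟩
      loopless := ⟨by
        rintro x (⟨_, h, _⟩ | ⟨_, h, _⟩)
        · exact h rfl
        · exact h rfl⟩ }

/-- The 2-covering network `N[2]`; the signs `{-1, 1}` are the units of `ℤ`. -/
abbrev coveringNetwork (F₁ : T₁ ⥤q Q) (F₂ : T₂ ⥤q Q) : Network where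
  V := (pullbackNetwork F₁ F₂).V × ℤˣ
  A := (pullbackNetwork F₁ F₂).A × ℤˣ
  src a := ((pullbackNetwork F₁ F₂).src a.1, a.2)
  tgt a := ((pullbackNetwork F₁ F₂).tgt a.1, a.2)
  E :=
    { Adj := fun x y => (pullbackNetwork F₁ F₂).E.Adj x.1 y.1 ∧ y.2 = -x.2
      symm := ⟨by
        rintro x y ⟨h, h'⟩
        exact ⟨h.symm, by rw [h', neg_neg]⟩⟩
      loopless := ⟨by
        rintro x ⟨h, _⟩
        exact (pullbackNetwork F₁ F₂).E.irrefl h⟩ }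

variable {F₁ : T₁ ⥤q Q} {F₂ : T₂ ⥤q Q}

/-- The projection `π : N[2] → N[1]` on vertices. -/
def proj (x : (coveringNetwork F₁ F₂).V) : (pullbackNetwork F₁ F₂).V := x.1

/-- The projection `π : N[2] → N[1]` on links. -/
def projLink : (coveringNetwork F₁ F₂).Link → (pullbackNetwork F₁ F₂).Link
  | .arrow a => .arrow a.1
  | .inv a => .inv a.1
  | .edge x y h => .edge x.1 y.1 h.1

variable (F₁ F₂) in
/-- The set `R[1]` of traversals `x -- y -- z` of `N[1]` such that `x, y, z` span a triangle. -/
def blocked₁ : Set (List (pullbackNetwork F₁ F₂).Link) :=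
  {t | Network.IsTraversal t ∧ ∃ α β : (pullbackNetwork F₁ F₂).Link, t = [α, β] ∧
    (pullbackNetwork F₁ F₂).IsTriangle α.start α.finish β.finish}

variable (F₁ F₂) in
/-- The set `R[2]` of traversals of `N[2]` whose projection lies in `R[1]`. -/
def blocked₂ : Set (List (coveringNetwork F₁ F₂).Link) :=
  {t | Network.IsTraversal t ∧ t.map projLink ∈ blocked₁ F₁ F₂}

/-- Completeness of a subnetwork `M` of `N[2]`. Here `x = (n, m, j)`. -/
def IsComplete (M : (coveringNetwork F₁ F₂).Subnetwork) : Prop :=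
  ∀ x ∈ M.verts,
    (∀ a : Quiver.Total T₁, a.right = x.1.1.1 →
      (∃ e ∈ M.arrows, e.1.1.1 = a ∧ (coveringNetwork F₁ F₂).tgt e = x) ∨
      (∃ c : Quiver.Total T₁, c.left = a.left ∧ arrowMap F₁ a = arrowMap F₁ c ∧
        ∃ y ∈ M.verts, y.1.1 = (c.right, x.1.1.2) ∧ y.2 = -x.2 ∧ s(x, y) ∈ M.edges)) ∧
    (∀ b : Quiver.Total T₂, b.left = x.1.1.2 →
      (∃ e ∈ M.arrows, e.1.1.2 = b ∧ (coveringNetwork F₁ F₂).src e = x) ∨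
      (∃ d : Quiver.Total T₂, d.right = b.right ∧ arrowMap F₂ b = arrowMap F₂ d ∧
        ∃ y ∈ M.verts, y.1.1 = (x.1.1.1, d.left) ∧ y.2 = -x.2 ∧ s(x, y) ∈ M.edges))

/-- If `(n, m, j)` is a vertex of `M` then `(n, m, -j)` is not. -/
def IsInvolutionFree (M : (coveringNetwork F₁ F₂).Subnetwork) : Prop :=
  ∀ x ∈ M.verts, (x.1, -x.2) ∉ M.verts

/-- The vertex set of `M` is a union of fibres of `π`. -/
def IsInvolutionInvariant (M : (coveringNetwork F₁ F₂).Subnetwork) : Prop :=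
  M.verts = proj ⁻¹' (proj '' M.verts)

/-- Generalised graph maps. -/
structure IsGenGraphMap (M : (coveringNetwork F₁ F₂).Subnetwork) : Prop where
  nonempty : M.verts.Nonempty
  connected : M.graph.Connected
  involutionFree : IsInvolutionFree M
  complete : IsComplete M
  free : M.IsFreeOf (blocked₂ F₁ F₂)

/-- Ghosts. -/
structure IsGhost (M : (coveringNetwork F₁ F₂).Subnetwork) : Prop where
  nonempty : M.verts.Nonempty
  connected : M.graph.Connected
  involutionInvariant : IsInvolutionInvariant M
  complete : IsComplete M
  free : M.IsFreeOf (blocked₂ F₁ F₂)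

variable (F₁ F₂) in
/-- The pair of generalised tree modules given by `F₁` and `F₂` is ghost-free. -/
def GhostFree : Prop :=
  ∀ M : (coveringNetwork F₁ F₂).Subnetwork, ¬ IsGhost M

open Classical in
/-- The linear map `H_M : F₁_λ(V_{T₁}) → F₂_λ(V_{T₂})`, `v_n ↦ ∑_{(n, m, j) ∈ M₀} j w_m`, given by
its components at the vertices `i` of `Q`. -/
noncomputable def networkMap (K : Type*) [Field K] [IsTreeQuiver T₁] [IsTreeQuiver T₂]
    (ρ : ∀ i j : Q, Set (Quiver.Path i j))
    (hF₁ : IsBoundMorphism ρ F₁) (hF₂ : IsBoundMorphism ρ F₂)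
    (M : (coveringNetwork F₁ F₂).Subnetwork) (i : Q) :
    (genTreeModule K ρ F₁ hF₁).obj i →ₗ[K] (genTreeModule K ρ F₂ hF₂).obj i :=
  DirectSum.toModule K {n : T₁ // F₁.obj n = i} ((genTreeModule K ρ F₂ hF₂).obj i) fun n =>
    LinearMap.toSpanSingleton K ((genTreeModule K ρ F₂ hF₂).obj i)
      (∑ᶠ mj : {m : T₂ // F₂.obj m = i} × ℤˣ,
        if (⟨(n.1, mj.1.1), n.2.trans mj.1.2.symm⟩, mj.2) ∈ M.verts then
          (((mj.2 : ℤˣ) : ℤ) : K) • basisVec K ρ F₂ hF₂ mj.1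
        else 0)

end Networks

end GTM

/-! Write a family of linear maps from `M₁` to `M₂` as a matrix `h` indexed by the vertices `(n, m)`
of `N[1]`. It is a homomorphism exactly when, for all `(γ, n, m)`, the sum of `h (n', m)` over
arrows `n → n'` above `γ` equals the sum of `h (n, m')` over arrows `m' → m` above `γ`
(`mem_homSpace_iff`).

The network encodes these equations. Distinct variables of one equation are linked: by an edge if
they are on the same side, by an arrow if they are on opposite sides. Conversely every link arises
in this way, and since `T₁` and `T₂` are trees, the links of a triangle all come from one equation
(`eqIndex_eq_of_triangle`). The signs in `N[2]` are arranged so that linked vertices make opposite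
contributions `side e` to their equation. Completeness thus says that a vertex has at least one
partner in each of its equations, and `R[2]`-freeness that it has at most one. The contributions
cancel in pairs, so a complete free subnetwork yields a solution (`IsComplete.networkVec_mem`).
Conversely, any choice of such pairs (`IsPairing`) yields a complete free subnetwork, which becomes
connected on passing to an orbit.

For spanning, let `A` be the support of a nonzero solution. No equation involves exactly one element
of `A`, so the preimage of `A` in `N[2]` can be paired. An orbit of this pairing is not a ghost,
hence contains some vertex without its opposite. Discarding all opposite pairs from the orbit leaves
a nonempty involution-free set that still satisfies the equations; it can be paired anew, and an
orbit is a generalised graph map lying over `A` (`exists_isGenGraphMap`). Subtracting a multiple of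
its matrix shrinks the support, and induction finishes (`solutions_le_span`). -/

namespace GTM

/-! ### Configurations that cannot occur in a tree. -/

section Acyclic

variable {T : Type*}

theorem eq_of_adj_of_adj {G : SimpleGraph T} (hG : G.IsAcyclic) {p q u v : T}
    (huv : u ≠ v) (h1 : G.Adj p u) (h2 : G.Adj p v) (h3 : G.Adj q u) (h4 : G.Adj q v) :
    p = q := by
  let w₁ : G.Walk u v := .cons h1.symm (.cons h2 .nil)
  let w₂ : G.Walk u v := .cons h3.symm (.cons h4 .nil)
  have e : (⟨w₁, by simp [w₁, h1.ne', h2.ne, huv]⟩ : G.Path u v) =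
    ⟨w₂, by simp [w₂, h3.ne', h4.ne, huv]⟩ := (hG.subsingleton_path _ _).elim _ _
  have := congrArg (fun w => w.1.support) e
  simpa [w₁, w₂] using this

theorem not_adj_of_adj_adj {G : SimpleGraph T} (hG : G.IsAcyclic) {u v w : T}
    (h1 : G.Adj u v) (h2 : G.Adj v w) : ¬ G.Adj u w := by
  intro h3
  let w₁ : G.Walk u w := .cons h1 (.cons h2 .nil)
  let w₂ : G.Walk u w := .cons h3 .nil
  have e : (⟨w₁, by simp [w₁, h1.ne, h2.ne, h3.ne]⟩ : G.Path u w) =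
    ⟨w₂, by simp [w₂, h3.ne]⟩ := (hG.subsingleton_path _ _).elim _ _
  have := congrArg (fun w => w.1.length) e
  simp [w₁, w₂] at this

/-- If `p ≠ q`, then `u – p – v – q – w` is a path of length 4 beside the path `u – r – w` of length
2. The vertices of the long path are distinct because `p = w` or `q = u` would create a triangle. -/
theorem eq_of_hexagon {G : SimpleGraph T} (hG : G.IsAcyclic) {p q r u v w : T}
    (huv : u ≠ v) (hvw : v ≠ w) (huw : u ≠ w) (h1 : G.Adj p u) (h2 : G.Adj p v)
    (h3 : G.Adj q v) (h4 : G.Adj q w) (h5 : G.Adj r u) (h6 : G.Adj r w) : p = q := by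
  by_contra hpq
  have hpw : p ≠ w := by
    rintro rfl
    exact not_adj_of_adj_adj hG h6 h1 h5
  have hqu : q ≠ u := by
    rintro rfl
    exact not_adj_of_adj_adj hG h5 h4 h6
  let w₁ : G.Walk u w := .cons h1.symm (.cons h2 (.cons h3.symm (.cons h4 .nil)))
  let w₂ : G.Walk u w := .cons h5.symm (.cons h6 .nil)
  have e : (⟨w₁, by
      simp [w₁, h1.ne', h2.ne, h3.ne', h4.ne, huv, hvw, huw, hpq, hpw, hqu.symm]⟩ : G.Path u w) =
    ⟨w₂, by simp [w₂, h5.ne', h6.ne, huw]⟩ := (hG.subsingleton_path _ _).elim _ _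
  have := congrArg (fun w => w.1.length) e
  simp [w₁, w₂] at this

end Acyclic

section Tree

variable {T : Type*} [Quiver T]

/-- There is an arrow from `n` to `m`. -/
def HasArrow (n m : T) : Prop := ∃ a : Quiver.Total T, a.left = n ∧ a.right = m

variable [IsTreeQuiver T]

theorem HasArrow.ne {n m : T} (h : HasArrow n m) : n ≠ m := by
  obtain ⟨a, rfl, rfl⟩ := h
  exact IsTreeQuiver.no_loop a

theorem HasArrow.adj {n m : T} (h : HasArrow n m) :
    (SimpleGraph.fromRel fun n m : T => Nonempty (n ⟶ m)).Adj n m := by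
  refine (SimpleGraph.fromRel_adj _ _ _).2 ⟨h.ne, ?_⟩
  obtain ⟨a, rfl, rfl⟩ := h
  exact Or.inl ⟨a.hom⟩

theorem HasArrow.asymm {n m : T} (h : HasArrow n m) : ¬ HasArrow m n := by
  intro h'
  have hne := h.ne
  obtain ⟨a, rfl, rfl⟩ := h
  obtain ⟨b, h1, h2⟩ := h'
  have := IsTreeQuiver.no_multiple a b (by rw [h1, h2, Sym2.eq_swap])
  subst this
  exact hne h1

theorem total_ext {a b : Quiver.Total T} (hl : a.left = b.left) (hr : a.right = b.right) :
    a = b :=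
  IsTreeQuiver.no_multiple a b (by rw [hl, hr])

theorem HasArrow.source_unique {p q u v : T} (huv : u ≠ v) (h1 : HasArrow p u)
    (h2 : HasArrow p v) (h3 : HasArrow q u) (h4 : HasArrow q v) : p = q :=
  eq_of_adj_of_adj IsTreeQuiver.isTree.isAcyclic huv h1.adj h2.adj h3.adj h4.adj

theorem HasArrow.target_unique {p q u v : T} (huv : u ≠ v) (h1 : HasArrow u p)
    (h2 : HasArrow v p) (h3 : HasArrow u q) (h4 : HasArrow v q) : p = q :=
  eq_of_adj_of_adj IsTreeQuiver.isTree.isAcyclic huv h1.adj.symm h2.adj.symm h3.adj.symm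
    h4.adj.symm

theorem HasArrow.not_source_target {p q u v : T} (huv : u ≠ v) (h1 : HasArrow p u)
    (h2 : HasArrow p v) (h3 : HasArrow u q) (h4 : HasArrow v q) : False := by
  obtain rfl := eq_of_adj_of_adj IsTreeQuiver.isTree.isAcyclic huv h1.adj h2.adj h3.adj.symm
    h4.adj.symm
  exact h1.asymm h3

theorem HasArrow.not_trans {u v w : T} (h1 : HasArrow u v) (h2 : HasArrow v w) :
    ¬ HasArrow u w :=
  fun h3 => not_adj_of_adj_adj IsTreeQuiver.isTree.isAcyclic h1.adj h2.adj h3.adj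

theorem HasArrow.not_cyclic {u v w : T} (h1 : HasArrow u v) (h2 : HasArrow v w) :
    ¬ HasArrow w u :=
  fun h3 => not_adj_of_adj_adj IsTreeQuiver.isTree.isAcyclic h1.adj h2.adj h3.adj.symm

theorem HasArrow.not_common_source {p u v : T} (h1 : HasArrow p u) (h2 : HasArrow p v) :
    ¬ HasArrow u v :=
  fun h3 => not_adj_of_adj_adj IsTreeQuiver.isTree.isAcyclic h1.adj h3.adj h2.adj

theorem HasArrow.not_common_target {p u v : T} (h1 : HasArrow u p) (h2 : HasArrow v p) :
    ¬ HasArrow u v :=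
  fun h3 => not_adj_of_adj_adj IsTreeQuiver.isTree.isAcyclic h3.adj h2.adj h1.adj

theorem HasArrow.source_unique_of_triple {p q r u v w : T} (huv : u ≠ v) (hvw : v ≠ w)
    (huw : u ≠ w) (h1 : HasArrow p u) (h2 : HasArrow p v) (h3 : HasArrow q v) (h4 : HasArrow q w)
    (h5 : HasArrow r u) (h6 : HasArrow r w) : p = q :=
  eq_of_hexagon IsTreeQuiver.isTree.isAcyclic huv hvw huw h1.adj h2.adj h3.adj h4.adj h5.adj
    h6.adj

theorem HasArrow.target_unique_of_triple {p q r u v w : T} (huv : u ≠ v) (hvw : v ≠ w)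
    (huw : u ≠ w) (h1 : HasArrow u p) (h2 : HasArrow v p) (h3 : HasArrow v q) (h4 : HasArrow w q)
    (h5 : HasArrow u r) (h6 : HasArrow w r) : p = q :=
  eq_of_hexagon IsTreeQuiver.isTree.isAcyclic huv hvw huw h1.adj.symm h2.adj.symm h3.adj.symm
    h4.adj.symm h5.adj.symm h6.adj.symm

end Tree

/-! ### Triangles of variables come from a single node. -/

section Incidence

variable {T₁ T₂ : Type*} [Quiver T₁] [Quiver T₂]

/-- The variable `x = (n', m')` occurs in an equation with node `c = (n, m)`. -/
def Incident (c x : T₁ × T₂) : Prop :=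
  (x.2 = c.2 ∧ HasArrow c.1 x.1) ∨ (x.1 = c.1 ∧ HasArrow x.2 c.2)

/-- Each incidence is a step along an arrow of one of the two trees, so the closed chain `c, y, d,
z, e, x` projects to closed walks in both. In each of the 64 combinations of steps, acyclicity and
the orientation of the arrows force `c = d` or a contradiction. -/
theorem node_eq_of_triangle [IsTreeQuiver T₁] [IsTreeQuiver T₂] {c d e x y z : T₁ × T₂}
    (hxy : x ≠ y) (hyz : y ≠ z) (hxz : x ≠ z) (h1 : Incident c x) (h2 : Incident c y)
    (h3 : Incident d y) (h4 : Incident d z) (h5 : Incident e x) (h6 : Incident e z) : c = d := by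
  obtain ⟨c1, c2⟩ := c
  obtain ⟨d1, d2⟩ := d
  obtain ⟨e1, e2⟩ := e
  obtain ⟨x1, x2⟩ := x
  obtain ⟨y1, y2⟩ := y
  obtain ⟨z1, z2⟩ := z
  simp only [Incident, ne_eq, Prod.mk.injEq] at *
  rcases h1 with ⟨rfl, h1⟩ | ⟨rfl, h1⟩ <;> rcases h2 with ⟨rfl, h2⟩ | ⟨rfl, h2⟩ <;>
  rcases h3 with ⟨h3', h3⟩ | ⟨h3', h3⟩ <;> rcases h4 with ⟨h4', h4⟩ | ⟨h4', h4⟩ <;>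
  rcases h5 with ⟨h5', h5⟩ | ⟨h5', h5⟩ <;> rcases h6 with ⟨h6', h6⟩ | ⟨h6', h6⟩ <;>
  grind [→ HasArrow.source_unique, → HasArrow.target_unique, → HasArrow.ne, → HasArrow.asymm,
    → HasArrow.not_source_target, → HasArrow.not_trans, → HasArrow.not_common_source,
    → HasArrow.not_common_target, → HasArrow.source_unique_of_triple, → HasArrow.not_cyclic,
    → HasArrow.target_unique_of_triple]

end Incidence

/-! ### The linear equations for homomorphisms and their relation to links. -/

section Equations

variable {T₁ T₂ Q : Type*} [Quiver T₁] [Quiver T₂] [Quiver Q] {F₁ : T₁ ⥤q Q} {F₂ : T₂ ⥤q Q}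

/-- The indices `(γ, n, m)` of the linear equations
`∑_{a : n → n', F₁(a) = γ} h(n', m) = ∑_{b : m' → m, F₂(b) = γ} h(n, m')`
which describe the homomorphisms with matrix `h`. -/
abbrev EqIndex (T₁ T₂ Q : Type*) [Quiver Q] := Quiver.Total Q × T₁ × T₂

/-- The variable `x` occurs on the left hand side of the equation `e`. -/
def OnLeft (e : EqIndex T₁ T₂ Q) (x : (pullbackNetwork F₁ F₂).V) : Prop :=
  x.1.2 = e.2.2 ∧ ∃ a : Quiver.Total T₁, a.left = e.2.1 ∧ a.right = x.1.1 ∧ arrowMap F₁ a = e.1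

/-- The variable `x` occurs on the right hand side of the equation `e`. -/
def OnRight (e : EqIndex T₁ T₂ Q) (x : (pullbackNetwork F₁ F₂).V) : Prop :=
  x.1.1 = e.2.1 ∧ ∃ b : Quiver.Total T₂, b.left = x.1.2 ∧ b.right = e.2.2 ∧ arrowMap F₂ b = e.1

open Classical in
/-- The coefficient of the variable `x` in the equation `e`. -/
noncomputable def sgn (e : EqIndex T₁ T₂ Q) (x : (pullbackNetwork F₁ F₂).V) : ℤ :=
  if OnLeft e x then 1 else if OnRight e x then -1 else 0

/-- The coefficient of `x` in the equation `e`, multiplied by the sign `j`, for a vertex `(x, j)`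
of the 2-covering network. -/
noncomputable def side (e : EqIndex T₁ T₂ Q) (p : (coveringNetwork F₁ F₂).V) : ℤ :=
  sgn e p.1 * (p.2 : ℤ)

theorem OnLeft.sgn_eq {e : EqIndex T₁ T₂ Q} {x : (pullbackNetwork F₁ F₂).V} (h : OnLeft e x) :
    sgn e x = 1 := if_pos h

theorem OnLeft.not_onRight [IsTreeQuiver T₁] {e : EqIndex T₁ T₂ Q}
    {x : (pullbackNetwork F₁ F₂).V} (h : OnLeft e x) : ¬ OnRight e x := by
  rintro ⟨h1, -⟩
  obtain ⟨-, a, h2, h3, -⟩ := h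
  exact IsTreeQuiver.no_loop a (by rw [h2, h3, h1])

theorem OnRight.sgn_eq [IsTreeQuiver T₁] {e : EqIndex T₁ T₂ Q} {x : (pullbackNetwork F₁ F₂).V}
    (h : OnRight e x) : sgn e x = -1 := by
  rw [sgn, if_neg (fun h' => h'.not_onRight h), if_pos h]

theorem onLeft_or_onRight {e : EqIndex T₁ T₂ Q} {x : (pullbackNetwork F₁ F₂).V}
    (h : sgn e x ≠ 0) : OnLeft e x ∨ OnRight e x := by
  by_contra! h'
  exact h (by rw [sgn, if_neg h'.1, if_neg h'.2])

theorem sgn_mem (e : EqIndex T₁ T₂ Q) (x : (pullbackNetwork F₁ F₂).V) :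
    sgn e x = 0 ∨ sgn e x = 1 ∨ sgn e x = -1 := by
  unfold sgn
  split_ifs <;> simp

theorem side_ne_zero {e : EqIndex T₁ T₂ Q} {p : (coveringNetwork F₁ F₂).V} :
    side e p ≠ 0 ↔ sgn e p.1 ≠ 0 := by
  simp [side]

theorem side_neg (e : EqIndex T₁ T₂ Q) (x : (pullbackNetwork F₁ F₂).V) (j : ℤˣ) :
    side e (x, -j) = -side e (x, j) := by
  simp [side]

theorem side_mem (e : EqIndex T₁ T₂ Q) (p : (coveringNetwork F₁ F₂).V) :
    side e p = 0 ∨ side e p = 1 ∨ side e p = -1 := by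
  rcases sgn_mem e p.1 with h | h | h <;> rcases Int.units_eq_one_or p.2 with h' | h' <;>
    simp [side, h, h']

/-- A variable that occurs in `e` has exactly two lifts to `N[2]`, one for each value `1`, `-1` of
`side e`. -/
theorem eq_of_side_eq {e : EqIndex T₁ T₂ Q} {p q : (coveringNetwork F₁ F₂).V} (h1 : p.1 = q.1)
    (h2 : side e p = side e q) (h3 : side e p ≠ 0) : p = q := by
  refine Prod.ext h1 (Units.ext ?_)
  rw [side_ne_zero] at h3
  simp only [side, ← h1] at h2
  exact mul_left_cancel₀ h3 h2

theorem incident_of_sgn_ne_zero {e : EqIndex T₁ T₂ Q} {x : (pullbackNetwork F₁ F₂).V}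
    (h : sgn e x ≠ 0) : Incident e.2 x.1 := by
  rcases onLeft_or_onRight h with ⟨h1, a, h2, h3, -⟩ | ⟨h1, b, h2, h3, -⟩
  · exact Or.inl ⟨h1, a, h2, h3⟩
  · exact Or.inr ⟨h1, b, h2, h3⟩

/-- An arrow of a tree is determined by its endpoints, so the node and one variable determine the
arrow of `Q`. If `x` were on different sides of `e` and `f`, some arrow would be a loop. -/
theorem eqIndex_ext [IsTreeQuiver T₁] [IsTreeQuiver T₂] {e f : EqIndex T₁ T₂ Q}
    {x : (pullbackNetwork F₁ F₂).V} (he : sgn e x ≠ 0) (hf : sgn f x ≠ 0) (h : e.2 = f.2) :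
    e = f := by
  refine Prod.ext ?_ h
  rcases onLeft_or_onRight he with ⟨h1, a, h2, h3, h4⟩ | ⟨h1, a, h2, h3, h4⟩ <;>
    rcases onLeft_or_onRight hf with ⟨h1', a', h2', h3', h4'⟩ | ⟨h1', a', h2', h3', h4'⟩
  · have : a = a' := total_ext (by rw [h2, h2', h]) (by rw [h3, h3'])
    rw [← h4, ← h4', this]
  · exact absurd (by rw [h2, h3, h1', h]) (IsTreeQuiver.no_loop a)
  · exact absurd (by rw [h2', h3', h1, h]) (IsTreeQuiver.no_loop a')
  · have : a = a' := total_ext (by rw [h2, h2']) (by rw [h3, h3', h])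
    rw [← h4, ← h4', this]

theorem exists_eqIndex_of_adj {x y : (pullbackNetwork F₁ F₂).V}
    (h : (pullbackNetwork F₁ F₂).E.Adj x y) :
    ∃ e : EqIndex T₁ T₂ Q, (OnLeft e x ∧ OnLeft e y) ∨ (OnRight e x ∧ OnRight e y) := by
  rcases h with ⟨h, -, a, b, h1, h2, h3, h4⟩ | ⟨h, -, a, b, h1, h2, h3, h4⟩
  · exact ⟨(arrowMap F₁ a, a.left, x.1.2), Or.inl
      ⟨⟨rfl, a, rfl, h2, rfl⟩, ⟨h.symm, b, h1.symm, h3, h4.symm⟩⟩⟩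
  · exact ⟨(arrowMap F₂ a, x.1.1, a.right), Or.inr
      ⟨⟨rfl, a, h2, rfl, rfl⟩, ⟨h.symm, b, h3, h1.symm, h4.symm⟩⟩⟩

/-- The equation to which an arrow of the pullback network belongs. -/
def arrowEq (a : (pullbackNetwork F₁ F₂).A) : EqIndex T₁ T₂ Q :=
  (arrowMap F₁ a.1.1, a.1.1.left, a.1.2.right)

theorem onRight_src (a : (pullbackNetwork F₁ F₂).A) :
    OnRight (arrowEq a) ((pullbackNetwork F₁ F₂).src a) :=
  ⟨rfl, a.1.2, rfl, rfl, a.2.symm⟩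

theorem onLeft_tgt (a : (pullbackNetwork F₁ F₂).A) :
    OnLeft (arrowEq a) ((pullbackNetwork F₁ F₂).tgt a) :=
  ⟨rfl, a.1.1, rfl, rfl, rfl⟩

theorem exists_eqIndex_of_linked [IsTreeQuiver T₁] {x y : (pullbackNetwork F₁ F₂).V}
    (h : (pullbackNetwork F₁ F₂).Linked x y) :
    ∃ e : EqIndex T₁ T₂ Q, sgn e x ≠ 0 ∧ sgn e y ≠ 0 := by
  obtain ⟨α, rfl, rfl⟩ := h
  cases α with
  | arrow a =>
    exact ⟨arrowEq a, by simp [Network.Link.start, (onRight_src a).sgn_eq],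
      by simp [Network.Link.finish, (onLeft_tgt a).sgn_eq]⟩
  | inv a =>
    exact ⟨arrowEq a, by simp [Network.Link.start, (onLeft_tgt a).sgn_eq],
      by simp [Network.Link.finish, (onRight_src a).sgn_eq]⟩
  | edge x y h =>
    obtain ⟨e, ⟨h1, h2⟩ | ⟨h1, h2⟩⟩ := exists_eqIndex_of_adj h
    · exact ⟨e, by simp [Network.Link.start, h1.sgn_eq], by simp [Network.Link.finish, h2.sgn_eq]⟩
    · exact ⟨e, by simp [Network.Link.start, h1.sgn_eq], by simp [Network.Link.finish, h2.sgn_eq]⟩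

theorem adj_of_onLeft {e : EqIndex T₁ T₂ Q} {x y : (pullbackNetwork F₁ F₂).V} (hne : x ≠ y)
    (hx : OnLeft e x) (hy : OnLeft e y) : (pullbackNetwork F₁ F₂).E.Adj x y := by
  obtain ⟨h1, a, h2, h3, h4⟩ := hx
  obtain ⟨h1', a', h2', h3', h4'⟩ := hy
  exact Or.inl ⟨h1.trans h1'.symm,
    fun h => hne (Subtype.ext (Prod.ext h (h1.trans h1'.symm))),
    a, a', h2.trans h2'.symm, h3, h3', h4.trans h4'.symm⟩

theorem adj_of_onRight {e : EqIndex T₁ T₂ Q} {x y : (pullbackNetwork F₁ F₂).V} (hne : x ≠ y)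
    (hx : OnRight e x) (hy : OnRight e y) : (pullbackNetwork F₁ F₂).E.Adj x y := by
  obtain ⟨h1, a, h2, h3, h4⟩ := hx
  obtain ⟨h1', a', h2', h3', h4'⟩ := hy
  exact Or.inr ⟨h1.trans h1'.symm,
    fun h => hne (Subtype.ext (Prod.ext (h1.trans h1'.symm) h)),
    a, a', h3.trans h3'.symm, h2, h2', h4.trans h4'.symm⟩

/-- If `y` is on the right and `x` is on the left of an equation, then there is an arrow `y → x`
of the pullback network over any arrow of `T₁` and of `T₂` that shows this. -/
theorem exists_arrow {e : EqIndex T₁ T₂ Q} {x y : (pullbackNetwork F₁ F₂).V}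
    {a : Quiver.Total T₁} {b : Quiver.Total T₂} (hx : x.1.2 = e.2.2) (ha1 : a.left = e.2.1)
    (ha2 : a.right = x.1.1) (ha : arrowMap F₁ a = e.1) (hy : y.1.1 = e.2.1)
    (hb1 : b.left = y.1.2) (hb2 : b.right = e.2.2) (hb : arrowMap F₂ b = e.1) :
    ∃ c : (pullbackNetwork F₁ F₂).A, c.1 = (a, b) ∧ (pullbackNetwork F₁ F₂).src c = y ∧
      (pullbackNetwork F₁ F₂).tgt c = x :=
  ⟨⟨(a, b), ha.trans hb.symm⟩, rfl,
    Subtype.ext (Prod.ext (ha1.trans hy.symm) hb1), Subtype.ext (Prod.ext ha2 (hb2.trans hx.symm))⟩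

theorem linked_of_sgn_ne_zero {e : EqIndex T₁ T₂ Q} {x y : (pullbackNetwork F₁ F₂).V}
    (hne : x ≠ y) (hx : sgn e x ≠ 0) (hy : sgn e y ≠ 0) :
    (pullbackNetwork F₁ F₂).Linked x y := by
  rcases onLeft_or_onRight hx with hx | hx <;> rcases onLeft_or_onRight hy with hy | hy
  · exact ⟨.edge x y (adj_of_onLeft hne hx hy), rfl, rfl⟩
  · obtain ⟨h1, a, h2, h3, h4⟩ := hx
    obtain ⟨h1', a', h2', h3', h4'⟩ := hy
    obtain ⟨c, -, hc1, hc2⟩ := exists_arrow h1 h2 h3 h4 h1' h2' h3' h4'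
    exact ⟨.inv c, hc2, hc1⟩
  · obtain ⟨h1, a, h2, h3, h4⟩ := hy
    obtain ⟨h1', a', h2', h3', h4'⟩ := hx
    obtain ⟨c, -, hc1, hc2⟩ := exists_arrow h1 h2 h3 h4 h1' h2' h3' h4'
    exact ⟨.arrow c, hc1, hc2⟩
  · exact ⟨.edge x y (adj_of_onRight hne hx hy), rfl, rfl⟩

/-- Any two links of a triangle of the pullback network belong to the same equation. -/
theorem eqIndex_eq_of_triangle [IsTreeQuiver T₁] [IsTreeQuiver T₂] {e f : EqIndex T₁ T₂ Q}
    {x y z : (pullbackNetwork F₁ F₂).V} (h : (pullbackNetwork F₁ F₂).IsTriangle x y z)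
    (hx : sgn e x ≠ 0) (hy : sgn e y ≠ 0) (hy' : sgn f y ≠ 0) (hz : sgn f z ≠ 0) : e = f := by
  obtain ⟨hxy, hyz, hxz, -, -, hl⟩ := h
  obtain ⟨g, hx', hz'⟩ := exists_eqIndex_of_linked hl
  refine eqIndex_ext hy hy' (node_eq_of_triangle (fun h => hxy (Subtype.ext h))
    (fun h => hyz (Subtype.ext h)) (fun h => hxz (Subtype.ext h)) (incident_of_sgn_ne_zero hx)
    (incident_of_sgn_ne_zero hy) (incident_of_sgn_ne_zero hy') (incident_of_sgn_ne_zero hz)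
    (incident_of_sgn_ne_zero hx') (incident_of_sgn_ne_zero hz'))

/-! ### Complete subnetworks define solutions -/

/-- The vertices `p` and `q` are joined by a link of `M` that belongs to the equation `e`. -/
structure IsMate (M : (coveringNetwork F₁ F₂).Subnetwork) (e : EqIndex T₁ T₂ Q)
    (p q : (coveringNetwork F₁ F₂).V) : Prop where
  side_ne : side e p ≠ 0
  side_eq : side e q = -side e p
  proj_ne : p.1 ≠ q.1
  link : ∃ α : (coveringNetwork F₁ F₂).Link, M.HasLink α ∧ α.start = p ∧ α.finish = q

theorem hasLink_reverse {N : Network} {M : N.Subnetwork} {α : N.Link} (h : M.HasLink α) :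
    M.HasLink α.reverse := by
  cases α with
  | arrow a => exact h
  | inv a => exact h
  | edge x y h' =>
    change s(y, x) ∈ M.edges
    rw [Sym2.eq_swap]
    exact h

theorem start_reverse {N : Network} (α : N.Link) : α.reverse.start = α.finish := by
  cases α <;> rfl

theorem finish_reverse {N : Network} (α : N.Link) : α.reverse.finish = α.start := by
  cases α <;> rfl

theorem start_projLink (α : (coveringNetwork F₁ F₂).Link) : (projLink α).start = α.start.1 := by
  cases α <;> rfl

theorem finish_projLink (α : (coveringNetwork F₁ F₂).Link) :
    (projLink α).finish = α.finish.1 := by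
  cases α <;> rfl

variable {M : (coveringNetwork F₁ F₂).Subnetwork} {e : EqIndex T₁ T₂ Q}
  {p q r : (coveringNetwork F₁ F₂).V}

theorem start_mem {N : Network} {M : N.Subnetwork} {α : N.Link} (h : M.HasLink α) :
    α.start ∈ M.verts := by
  cases α with
  | arrow a => exact M.src_mem a h
  | inv a => exact M.tgt_mem a h
  | edge x y h' => exact M.edge_mem _ h x (Sym2.mem_mk_left x y)

theorem IsMate.symm (h : IsMate M e p q) : IsMate M e q p := by
  obtain ⟨α, h1, h2, h3⟩ := h.link
  refine ⟨?_, ?_, h.proj_ne.symm, α.reverse, hasLink_reverse h1, ?_, ?_⟩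
  · rw [h.side_eq]
    exact neg_ne_zero.2 h.side_ne
  · rw [h.side_eq, neg_neg]
  · rw [start_reverse, h3]
  · rw [finish_reverse, h2]

theorem IsMate.mem (h : IsMate M e p q) : p ∈ M.verts := by
  obtain ⟨α, h1, rfl, -⟩ := h.link
  exact start_mem h1

/-- Two different partners `q`, `r` of `p` have the same side, hence different projections. The
projections of `q`, `p`, `r` all occur in `e` and so form a triangle, which makes the traversal `q –
p – r` blocked. -/
theorem IsMate.unique (hM : M.IsFreeOf (blocked₂ F₁ F₂)) (hq : IsMate M e p q)
    (hr : IsMate M e p r) : q = r := by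
  by_contra hne
  have hproj : q.1 ≠ r.1 := fun h =>
    hne (eq_of_side_eq h (hq.side_eq.trans hr.side_eq.symm) hq.symm.side_ne)
  obtain ⟨α, h1, h2, h3⟩ := hq.symm.link
  obtain ⟨β, h1', h2', h3'⟩ := hr.link
  have ht : Network.IsTraversal [α, β] := by
    refine List.isChain_pair.2 ⟨h3.trans h2'.symm, ?_⟩
    rintro rfl
    exact hne (by rw [← h2, ← h3', finish_reverse])
  refine hM [α, β] ⟨ht, by simp [h1, h1']⟩ ⟨ht, ?_, projLink α, projLink β, rfl, ?_⟩
  · refine List.isChain_pair.2 ⟨?_, ?_⟩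
    · rw [finish_projLink, start_projLink, h3, h2']
    · intro h
      apply hproj
      rw [← h2, ← h3', ← start_projLink, ← finish_projLink, h, finish_reverse]
  · rw [start_projLink, finish_projLink, finish_projLink, h2, h3, h3']
    exact ⟨hq.proj_ne.symm, hr.proj_ne, hproj,
      linked_of_sgn_ne_zero hq.proj_ne.symm (side_ne_zero.1 hq.symm.side_ne)
        (side_ne_zero.1 hq.side_ne),
      linked_of_sgn_ne_zero hr.proj_ne (side_ne_zero.1 hr.side_ne)
        (side_ne_zero.1 hr.symm.side_ne),
      linked_of_sgn_ne_zero hproj (side_ne_zero.1 hq.symm.side_ne)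
        (side_ne_zero.1 hr.symm.side_ne)⟩

/-- The first clause of completeness serves the equations with `p` on the left, the second those
with `p` on the right. In both, the arrow alternative gives a partner on the other side with equal
sign, the edge alternative one on the same side with opposite sign. -/
theorem IsComplete.exists_isMate [IsTreeQuiver T₁] (hM : IsComplete M) (hp : p ∈ M.verts)
    (he : side e p ≠ 0) : ∃ q, IsMate M e p q := by
  rcases onLeft_or_onRight (side_ne_zero.1 he) with hl | hl
  · obtain ⟨h1, a, h2, h3, h4⟩ := id hl
    rcases (hM p hp).1 a h3 with ⟨d, hd, rfl, rfl⟩ | ⟨c, hc, hac, y, hy, hy1, hy2, hyM⟩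
    · have hr : OnRight e ((coveringNetwork F₁ F₂).src d).1 :=
        ⟨h2, d.1.1.2, rfl, h1, by rw [← h4, d.1.2]⟩
      refine ⟨(coveringNetwork F₁ F₂).src d, he, ?_, ?_, .inv d, hd, rfl, rfl⟩
      · simp only [side, hl.sgn_eq, hr.sgn_eq]
        ring
      · intro h
        rw [← h] at hr
        exact hl.not_onRight hr
    · have hyl : OnLeft e y.1 :=
        ⟨by rw [hy1]; exact h1, c, by rw [hc, h2], by rw [hy1], by rw [← hac, h4]⟩
      have hadj := M.edges_subset hyM
      refine ⟨y, he, ?_, ?_, .edge p y hadj, hyM, rfl, rfl⟩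
      · simp only [side, hl.sgn_eq, hyl.sgn_eq, hy2]
        simp
      · exact fun h => (pullbackNetwork F₁ F₂).E.irrefl (h ▸ hadj.1)
  · obtain ⟨h1, b, h2, h3, h4⟩ := id hl
    rcases (hM p hp).2 b h2 with ⟨d, hd, rfl, rfl⟩ | ⟨c, hc, hac, y, hy, hy1, hy2, hyM⟩
    · have hr : OnLeft e ((coveringNetwork F₁ F₂).tgt d).1 :=
        ⟨h3, d.1.1.1, h1, rfl, by rw [← h4, d.1.2]⟩
      refine ⟨(coveringNetwork F₁ F₂).tgt d, he, ?_, ?_, .arrow d, hd, rfl, rfl⟩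
      · simp only [side, hl.sgn_eq, hr.sgn_eq]
        ring
      · intro h
        rw [← h] at hr
        exact hr.not_onRight hl
    · have hyl : OnRight e y.1 :=
        ⟨by rw [hy1]; exact h1, c, by rw [hy1], by rw [hc, h3], by rw [← hac, h4]⟩
      have hadj := M.edges_subset hyM
      refine ⟨y, he, ?_, ?_, .edge p y hadj, hyM, rfl, rfl⟩
      · simp only [side, hl.sgn_eq, hyl.sgn_eq, hy2]
        simp
      · exact fun h => (pullbackNetwork F₁ F₂).E.irrefl (h ▸ hadj.1)

-- Passing to the partner is a fixed-point-free involution that negates `side e`.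
open Classical in
theorem IsComplete.sum_side [IsTreeQuiver T₁] [Fintype (coveringNetwork F₁ F₂).V]
    (hM : IsComplete M) (hf : M.IsFreeOf (blocked₂ F₁ F₂)) (e : EqIndex T₁ T₂ Q) :
    ∑ p : (coveringNetwork F₁ F₂).V with p ∈ M.verts, side e p = 0 := by
  choose! g hg using fun p (hp : p ∈ M.verts) he => hM.exists_isMate (e := e) hp he
  rw [← Finset.sum_filter_ne_zero]
  refine Finset.sum_involution (fun p _ => g p) ?_ ?_ ?_ ?_ <;>
    simp only [Finset.mem_filter, Finset.mem_univ, true_and]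
  · intro p hp
    rw [(hg p hp.1 hp.2).side_eq, add_neg_cancel]
  · intro p hp _ h
    exact (hg p hp.1 hp.2).proj_ne (by rw [h])
  · intro p hp
    exact ⟨(hg p hp.1 hp.2).symm.mem, (hg p hp.1 hp.2).symm.side_ne⟩
  · intro p hp
    have h := (hg p hp.1 hp.2).symm
    exact (hg _ h.mem h.side_ne).unique hf h

end Equations
-- Pairings define complete, free and, on orbits, connected subnetworks.
section Pairing

variable {T₁ T₂ Q : Type*} [Quiver T₁] [Quiver T₂] [Quiver Q] {F₁ : T₁ ⥤q Q} {F₂ : T₂ ⥤q Q}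

/-- For every equation `e`, the vertices in `S` that occur in `e` are grouped by `τ e` into pairs of
opposite side and with distinct projections. -/
structure IsPairing (S : Set (coveringNetwork F₁ F₂).V)
    (τ : EqIndex T₁ T₂ Q → (coveringNetwork F₁ F₂).V → (coveringNetwork F₁ F₂).V) : Prop where
  mem : ∀ e, ∀ p ∈ S, side e p ≠ 0 → τ e p ∈ S
  side_eq : ∀ e, ∀ p ∈ S, side e p ≠ 0 → side e (τ e p) = -side e p
  invol : ∀ e, ∀ p ∈ S, side e p ≠ 0 → τ e (τ e p) = p
  proj_ne : ∀ e, ∀ p ∈ S, side e p ≠ 0 → (τ e p).1 ≠ p.1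

/-- The subnetwork with vertex set `S` whose links join the pairs of `τ`. -/
def pairingNetwork (S : Set (coveringNetwork F₁ F₂).V)
    (τ : EqIndex T₁ T₂ Q → (coveringNetwork F₁ F₂).V → (coveringNetwork F₁ F₂).V) :
    (coveringNetwork F₁ F₂).Subnetwork where
  verts := S
  arrows := {a | (coveringNetwork F₁ F₂).src a ∈ S ∧ (coveringNetwork F₁ F₂).tgt a ∈ S ∧
    ∃ e, side e ((coveringNetwork F₁ F₂).src a) ≠ 0 ∧
      τ e ((coveringNetwork F₁ F₂).src a) = (coveringNetwork F₁ F₂).tgt a}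
  edges := {s | ∃ x ∈ S, ∃ y ∈ S, s = s(x, y) ∧ (coveringNetwork F₁ F₂).E.Adj x y ∧
    ∃ e, side e x ≠ 0 ∧ τ e x = y}
  src_mem _ h := h.1
  tgt_mem _ h := h.2.1
  edges_subset := by
    rintro _ ⟨x, -, y, -, rfl, h, -⟩
    exact h
  edge_mem := by
    rintro _ ⟨x, hx, y, hy, rfl, -⟩ z hz
    rcases Sym2.mem_iff.1 hz with rfl | rfl
    · exact hx
    · exact hy

variable {S : Set (coveringNetwork F₁ F₂).V}
  {τ : EqIndex T₁ T₂ Q → (coveringNetwork F₁ F₂).V → (coveringNetwork F₁ F₂).V}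
  {e : EqIndex T₁ T₂ Q} {p : (coveringNetwork F₁ F₂).V}

theorem IsPairing.side_ne (h : IsPairing S τ) (hp : p ∈ S) (he : side e p ≠ 0) :
    side e (τ e p) ≠ 0 := by
  rw [h.side_eq e p hp he]
  exact neg_ne_zero.2 he

/-- The network records each pair in one direction only; as `τ e` is an involution, the partner
relation also holds for the reversed link. -/
theorem IsPairing.of_hasLink (h : IsPairing S τ) {α : (coveringNetwork F₁ F₂).Link}
    (hα : (pairingNetwork S τ).HasLink α) :
    ∃ e, side e α.start ≠ 0 ∧ τ e α.start = α.finish ∧ α.start ∈ S := by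
  cases α with
  | arrow a =>
    obtain ⟨h1, -, e, h2, h3⟩ := hα
    exact ⟨e, h2, h3, h1⟩
  | inv a =>
    obtain ⟨h1, h4, e, h2, h3⟩ := hα
    refine ⟨e, ?_, ?_, h4⟩
    · have := h.side_ne h1 h2
      rwa [h3] at this
    · change τ e ((coveringNetwork F₁ F₂).tgt a) = (coveringNetwork F₁ F₂).src a
      rw [← h3, h.invol e _ h1 h2]
  | edge x y hxy =>
    obtain ⟨x', hx', y', hy', heq, -, e, h2, h3⟩ := hα
    rcases Sym2.eq_iff.1 heq with ⟨rfl, rfl⟩ | ⟨rfl, rfl⟩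
    · exact ⟨e, h2, h3, hx'⟩
    · refine ⟨e, ?_, ?_, hy'⟩
      · exact h3 ▸ h.side_ne hx' h2
      · change τ e x = y
        rw [← h3, h.invol e _ hx' h2]

/-- Both links of a blocked traversal belong to the same equation. Since `τ e` is an involution, the
traversal returns to its starting point, while a triangle has distinct vertices. -/
theorem IsPairing.isFreeOf [IsTreeQuiver T₁] [IsTreeQuiver T₂] (h : IsPairing S τ) :
    (pairingNetwork S τ).IsFreeOf (blocked₂ F₁ F₂) := by
  rintro t ⟨h1, h2⟩ ⟨-, -, α', β', hmap, htri⟩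
  obtain ⟨α, t', rfl, rfl, ht'⟩ := List.map_eq_cons_iff.1 hmap
  obtain ⟨β, t', rfl, rfl, ht''⟩ := List.map_eq_cons_iff.1 ht'
  obtain rfl := List.map_eq_nil_iff.1 ht''
  have hab : α.finish = β.start := (List.isChain_pair.1 h1).1
  obtain ⟨e, he, heτ, heS⟩ := h.of_hasLink (h2 α (by simp))
  obtain ⟨f, hf, hfτ, hfS⟩ := h.of_hasLink (h2 β (by simp))
  rw [start_projLink, finish_projLink, finish_projLink] at htri
  have he' := h.side_ne heS he
  have hf' := h.side_ne hfS hf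
  rw [heτ] at he'
  rw [hfτ] at hf'
  obtain rfl : e = f := eqIndex_eq_of_triangle htri (side_ne_zero.1 he) (side_ne_zero.1 he')
    (hab ▸ side_ne_zero.1 hf) (side_ne_zero.1 hf')
  refine htri.2.2.1 ?_
  rw [← hfτ, ← hab, ← heτ, h.invol e _ heS he]

/-- Partners have opposite `side e`. If they are on the same side of `e`, their signs differ and an
edge joins them; if they are on opposite sides, their signs agree and an arrow joins them. -/
theorem IsPairing.isComplete [IsTreeQuiver T₁] (h : IsPairing S τ) :
    IsComplete (pairingNetwork S τ) := by
  intro p hp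
  refine ⟨fun a ha => ?_, fun b hb => ?_⟩
  · set e : EqIndex T₁ T₂ Q := (arrowMap F₁ a, a.left, p.1.1.2)
    have hl : OnLeft e p.1 := ⟨rfl, a, rfl, ha, rfl⟩
    have he : side e p ≠ 0 := side_ne_zero.2 (by simp [hl.sgn_eq])
    have hq := h.mem e p hp he
    have hs := h.side_eq e p hp he
    have hi := h.invol e p hp he
    have hn := h.proj_ne e p hp he
    have hqs := h.side_ne hp he
    generalize τ e p = q at hq hs hi hn hqs
    rcases onLeft_or_onRight (side_ne_zero.1 hqs) with hr | hr
    · have hj : q.2 = -p.2 := Units.ext (by simpa [side, hl.sgn_eq, hr.sgn_eq] using hs)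
      obtain ⟨h1, c, h2, h3, h4⟩ := id hr
      refine Or.inr ⟨c, h2, h4.symm, q, hq, Prod.ext h3.symm h1, hj, p, hp, q, hq, rfl,
        ⟨adj_of_onLeft hn.symm hl hr, hj⟩, e, he, ?_⟩
      rw [← hi, h.invol e q hq hqs]
    · have hj : q.2 = p.2 := Units.ext (by simpa [side, hl.sgn_eq, hr.sgn_eq] using hs)
      obtain ⟨h1, b, h2, h3, h4⟩ := id hr
      obtain ⟨c, hc, hc1, hc2⟩ := exists_arrow (e := e) (x := p.1) (a := a) rfl rfl ha
        rfl h1 h2 h3 h4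
      have hsrc : (coveringNetwork F₁ F₂).src (c, p.2) = q := Prod.ext hc1 hj.symm
      have htgt : (coveringNetwork F₁ F₂).tgt (c, p.2) = p := Prod.ext hc2 rfl
      refine Or.inl ⟨(c, p.2), ⟨?_, ?_, e, ?_, ?_⟩, by rw [hc], htgt⟩
      · rw [hsrc]; exact hq
      · rw [htgt]; exact hp
      · rw [hsrc]; exact hqs
      · rw [hsrc, htgt]; exact hi
  · set e : EqIndex T₁ T₂ Q := (arrowMap F₂ b, p.1.1.1, b.right)
    have hl : OnRight e p.1 := ⟨rfl, b, hb, rfl, rfl⟩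
    have he : side e p ≠ 0 := side_ne_zero.2 (by simp [hl.sgn_eq])
    have hq := h.mem e p hp he
    have hs := h.side_eq e p hp he
    have hi := h.invol e p hp he
    have hn := h.proj_ne e p hp he
    have hqs := h.side_ne hp he
    generalize hτ : τ e p = q at hq hs hi hn hqs
    rcases onLeft_or_onRight (side_ne_zero.1 hqs) with hr | hr
    · have hj : q.2 = p.2 := Units.ext (by simpa [side, hl.sgn_eq, hr.sgn_eq] using hs)
      obtain ⟨h1, a, h2, h3, h4⟩ := id hr
      obtain ⟨c, hc, hc1, hc2⟩ := exists_arrow (e := e) (y := p.1) (b := b) h1 h2 h3 h4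
        rfl hb rfl rfl
      have hsrc : (coveringNetwork F₁ F₂).src (c, p.2) = p := Prod.ext hc1 rfl
      have htgt : (coveringNetwork F₁ F₂).tgt (c, p.2) = q := Prod.ext hc2 hj.symm
      refine Or.inl ⟨(c, p.2), ⟨?_, ?_, e, ?_, ?_⟩, by rw [hc], hsrc⟩
      · rw [hsrc]; exact hp
      · rw [htgt]; exact hq
      · rw [hsrc]; exact he
      · rw [hsrc, htgt]; exact hτ
    · have hj : q.2 = -p.2 :=
        Units.ext (by simpa [side, hl.sgn_eq, hr.sgn_eq, neg_eq_iff_eq_neg] using hs)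
      obtain ⟨h1, c, h2, h3, h4⟩ := id hr
      exact Or.inr ⟨c, h3, h4.symm, q, hq, Prod.ext h1 h2.symm, hj, p, hp, q, hq, rfl,
        ⟨adj_of_onRight hn.symm hl hr, hj⟩, e, he, hτ⟩

theorem IsPairing.exists_hasLink (h : IsPairing S τ) (hp : p ∈ S) (he : side e p ≠ 0)
    [IsTreeQuiver T₁] :
    ∃ α, (pairingNetwork S τ).HasLink α ∧ α.start = p ∧ α.finish = τ e p := by
  have hq := h.mem e p hp he
  have hs := h.side_eq e p hp he
  have hn := h.proj_ne e p hp he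
  have hqs := h.side_ne hp he
  rcases onLeft_or_onRight (side_ne_zero.1 he) with hl | hl <;>
    rcases onLeft_or_onRight (side_ne_zero.1 hqs) with hr | hr
  · have hj : (τ e p).2 = -p.2 := Units.ext (by simpa [side, hl.sgn_eq, hr.sgn_eq] using hs)
    have hadj : (coveringNetwork F₁ F₂).E.Adj p (τ e p) := ⟨adj_of_onLeft hn.symm hl hr, hj⟩
    exact ⟨.edge p (τ e p) hadj, ⟨p, hp, _, hq, rfl, hadj, e, he, rfl⟩, rfl, rfl⟩
  · have hj : (τ e p).2 = p.2 := Units.ext (by simpa [side, hl.sgn_eq, hr.sgn_eq] using hs)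
    obtain ⟨h1, a, h2, h3, h4⟩ := id hl
    obtain ⟨h1', b, h2', h3', h4'⟩ := id hr
    obtain ⟨c, -, hc1, hc2⟩ := exists_arrow h1 h2 h3 h4 h1' h2' h3' h4'
    have hsrc : (coveringNetwork F₁ F₂).src (c, p.2) = τ e p := Prod.ext hc1 hj.symm
    have htgt : (coveringNetwork F₁ F₂).tgt (c, p.2) = p := Prod.ext hc2 rfl
    refine ⟨.inv (c, p.2), ⟨?_, ?_, e, ?_, ?_⟩, htgt, hsrc⟩
    · rw [hsrc]; exact hq
    · rw [htgt]; exact hp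
    · rw [hsrc]; exact hqs
    · rw [hsrc, htgt]; exact h.invol e p hp he
  · have hj : (τ e p).2 = p.2 := Units.ext (by simpa [side, hl.sgn_eq, hr.sgn_eq] using hs)
    obtain ⟨h1, a, h2, h3, h4⟩ := id hr
    obtain ⟨h1', b, h2', h3', h4'⟩ := id hl
    obtain ⟨c, -, hc1, hc2⟩ := exists_arrow h1 h2 h3 h4 h1' h2' h3' h4'
    have hsrc : (coveringNetwork F₁ F₂).src (c, p.2) = p := Prod.ext hc1 rfl
    have htgt : (coveringNetwork F₁ F₂).tgt (c, p.2) = τ e p := Prod.ext hc2 hj.symm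
    refine ⟨.arrow (c, p.2), ⟨?_, ?_, e, ?_, ?_⟩, hsrc, htgt⟩
    · rw [hsrc]; exact hp
    · rw [htgt]; exact hq
    · rw [hsrc]; exact he
    · rw [hsrc, htgt]
  · have hj : (τ e p).2 = -p.2 :=
      Units.ext (by simpa [side, hl.sgn_eq, hr.sgn_eq, neg_eq_iff_eq_neg] using hs)
    have hadj : (coveringNetwork F₁ F₂).E.Adj p (τ e p) := ⟨adj_of_onRight hn.symm hl hr, hj⟩
    exact ⟨.edge p (τ e p) hadj, ⟨p, hp, _, hq, rfl, hadj, e, he, rfl⟩, rfl, rfl⟩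

variable (τ) in
/-- The vertices that can be reached from `p` by passing to partners. -/
def orbit (p : (coveringNetwork F₁ F₂).V) : Set (coveringNetwork F₁ F₂).V :=
  {q | Relation.ReflTransGen (fun x y => ∃ e, side e x ≠ 0 ∧ τ e x = y) p q}

theorem IsPairing.orbit_subset (h : IsPairing S τ) (hp : p ∈ S) : orbit τ p ⊆ S := by
  intro q hq
  induction hq with
  | refl => exact hp
  | tail _ hxy ih =>
    obtain ⟨e, he, rfl⟩ := hxy
    exact h.mem e _ ih he

theorem IsPairing.isPairing_orbit (h : IsPairing S τ) (hp : p ∈ S) :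
    IsPairing (orbit τ p) τ where
  mem e _ hq he := Relation.ReflTransGen.tail hq ⟨e, he, rfl⟩
  side_eq e q hq := h.side_eq e q (h.orbit_subset hp hq)
  invol e q hq := h.invol e q (h.orbit_subset hp hq)
  proj_ne e q hq := h.proj_ne e q (h.orbit_subset hp hq)

theorem IsPairing.connected_orbit [IsTreeQuiver T₁] (h : IsPairing S τ) (hp : p ∈ S) :
    (pairingNetwork (orbit τ p) τ).graph.Connected := by
  have hO := h.isPairing_orbit hp
  have hp' : p ∈ orbit τ p := Relation.ReflTransGen.refl
  rw [SimpleGraph.connected_iff_exists_forall_reachable]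
  refine ⟨⟨p, hp'⟩, ?_⟩
  rintro ⟨q, hq⟩
  have key : ∀ q, q ∈ orbit τ p → ∀ hq : q ∈ (pairingNetwork (orbit τ p) τ).verts,
      (pairingNetwork (orbit τ p) τ).graph.Reachable ⟨p, hp'⟩ ⟨q, hq⟩ := by
    intro q hq
    induction hq with
    | refl => exact fun _ => SimpleGraph.Reachable.refl _
    | @tail x y hx hxy ih =>
      intro hy
      refine (ih hx).trans (SimpleGraph.Adj.reachable ?_)
      obtain ⟨e, he, rfl⟩ := hxy
      refine (SimpleGraph.fromRel_adj _ _ _).2 ⟨?_, Or.inl (hO.exists_hasLink hx he)⟩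
      intro h'
      exact hO.proj_ne e x hx he (congrArg (fun v => v.1.1) h').symm
  exact key q hq hq

end Pairing
-- Existence of a generalised graph map over a given set of variables.
section Existence

variable {T₁ T₂ Q : Type*} [Quiver T₁] [Quiver T₂] [Quiver Q] {F₁ : T₁ ⥤q Q} {F₂ : T₂ ⥤q Q}
  {S : Set (coveringNetwork F₁ F₂).V}

-- On `S`, the bijection is used on side `1` and its inverse on side `-1`. Elsewhere `τ e` is the
-- identity, a value that no clause of `IsPairing` inspects.
open Classical in
theorem exists_isPairing_of_equiv
    (φ : ∀ e : EqIndex T₁ T₂ Q, {p // p ∈ S ∧ side e p = 1} ≃ {p // p ∈ S ∧ side e p = -1})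
    (hφ : ∀ e p, (φ e p).1.1 ≠ p.1.1) : ∃ τ, IsPairing S τ := by
  let τ : EqIndex T₁ T₂ Q → (coveringNetwork F₁ F₂).V → (coveringNetwork F₁ F₂).V := fun e p =>
    if h : p ∈ S ∧ side e p = 1 then (φ e ⟨p, h⟩).1
    else if h : p ∈ S ∧ side e p = -1 then ((φ e).symm ⟨p, h⟩).1 else p
  have pos : ∀ e (p : {p // p ∈ S ∧ side e p = 1}), τ e p.1 = (φ e p).1 := fun e p => dif_pos p.2
  have neg : ∀ e (p : {p // p ∈ S ∧ side e p = -1}), τ e p.1 = ((φ e).symm p).1 := fun e p => by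
    have h : ¬ (p.1 ∈ S ∧ side e p.1 = 1) := by
      rw [p.2.2]
      norm_num
    simp only [τ]
    rw [dif_neg h, dif_pos p.2]
  have key : ∀ e, ∀ p ∈ S, side e p ≠ 0 → τ e p ∈ S ∧ side e (τ e p) = -side e p ∧
      τ e (τ e p) = p ∧ (τ e p).1 ≠ p.1 := by
    intro e p hp he
    rcases side_mem e p with h | h | h
    · exact absurd h he
    · have hτ := pos e ⟨p, hp, h⟩
      simp only at hτ
      rw [hτ, neg, Equiv.symm_apply_apply]
      exact ⟨(φ e _).2.1, (φ e _).2.2.trans (by rw [h]), rfl, hφ e _⟩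
    · have hτ := neg e ⟨p, hp, h⟩
      simp only at hτ
      rw [hτ, pos, Equiv.apply_symm_apply]
      refine ⟨((φ e).symm _).2.1, ((φ e).symm _).2.2.trans (by rw [h, neg_neg]), rfl, ?_⟩
      have := hφ e ((φ e).symm ⟨p, hp, h⟩)
      rw [Equiv.apply_symm_apply] at this
      exact this.symm
  exact ⟨τ, fun e p hp he => (key e p hp he).1, fun e p hp he => (key e p hp he).2.1,
    fun e p hp he => (key e p hp he).2.2.1, fun e p hp he => (key e p hp he).2.2.2⟩

theorem exists_side_eq {e : EqIndex T₁ T₂ Q} {x : (pullbackNetwork F₁ F₂).V} (h : sgn e x ≠ 0)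
    (j : ℤˣ) : ∃ i : ℤˣ, side e (x, i) = j := by
  rcases sgn_mem e x with h' | h' | h'
  · exact absurd h' h
  · exact ⟨j, by simp [side, h']⟩
  · exact ⟨-j, by simp [side, h']⟩

open Classical in
/-- If no equation contains exactly one element of `A`, then the preimage of `A` has a pairing. -/
theorem exists_isPairing_preimage [Finite (pullbackNetwork F₁ F₂).V]
    (A : Set (pullbackNetwork F₁ F₂).V)
    (hA : ∀ e : EqIndex T₁ T₂ Q, ∀ x ∈ A, sgn e x ≠ 0 → ∃ y ∈ A, y ≠ x ∧ sgn e y ≠ 0) :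
    ∃ τ : EqIndex T₁ T₂ Q → _, IsPairing {p : (coveringNetwork F₁ F₂).V | p.1 ∈ A} τ := by
  have := Fintype.ofFinite (pullbackNetwork F₁ F₂).V
  have hσ : ∀ e : EqIndex T₁ T₂ Q, ∃ σ : Equiv.Perm (pullbackNetwork F₁ F₂).V,
      ∀ x ∈ A, sgn e x ≠ 0 → σ x ≠ x ∧ (σ x ∈ A ∧ sgn e (σ x) ≠ 0) ∧
        (σ.symm x ∈ A ∧ sgn e (σ.symm x) ≠ 0) := by
    intro e
    -- Permute the variables of `e` lying in `A` in one cycle; it has no fixed point because `hA`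
    -- excludes a single such variable.
    obtain ⟨σ, hσ, -⟩ := Finset.exists_cycleOn
      (Finset.univ.filter fun x : (pullbackNetwork F₁ F₂).V => x ∈ A ∧ sgn e x ≠ 0)
    refine ⟨σ, fun x hx he => ?_⟩
    obtain ⟨y, hy, hne, hye⟩ := hA e x hx he
    have hx' : x ∈ ((Finset.univ.filter fun x : (pullbackNetwork F₁ F₂).V =>
      x ∈ A ∧ sgn e x ≠ 0 : Finset _) : Set (pullbackNetwork F₁ F₂).V) := by simp [hx, he]
    refine ⟨hσ.apply_ne ⟨x, hx', y, by simp [hy, hye], hne.symm⟩ hx', ?_, ?_⟩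
    · simpa using hσ.1.mapsTo hx'
    · have := hσ.inv.1.mapsTo hx'
      simpa using this
  choose σ hσ using hσ
  choose! s hs using fun (e : EqIndex T₁ T₂ Q) (x : (pullbackNetwork F₁ F₂).V) (j : ℤˣ)
    (h : sgn e x ≠ 0) => exists_side_eq h j
  have ne : ∀ {e : EqIndex T₁ T₂ Q} {p : (coveringNetwork F₁ F₂).V} {j : ℤˣ},
      side e p = j → sgn e p.1 ≠ 0 := fun {e p j} h => side_ne_zero.1 (by rw [h]; simp)
  have hpos : ∀ {e : EqIndex T₁ T₂ Q} {p : (coveringNetwork F₁ F₂).V},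
      side e p = 1 → sgn e p.1 ≠ 0 := fun h => ne (j := 1) (by simpa using h)
  have hneg : ∀ {e : EqIndex T₁ T₂ Q} {p : (coveringNetwork F₁ F₂).V},
      side e p = -1 → sgn e p.1 ≠ 0 := fun h => ne (j := -1) (by simpa using h)
  have sneg : ∀ {e : EqIndex T₁ T₂ Q} {x : (pullbackNetwork F₁ F₂).V}, sgn e x ≠ 0 →
      side e (x, s e x (-1)) = -1 := fun {e x} h => by simpa using hs e x (-1) h
  have spos : ∀ {e : EqIndex T₁ T₂ Q} {x : (pullbackNetwork F₁ F₂).V}, sgn e x ≠ 0 →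
      side e (x, s e x 1) = 1 := fun {e x} h => by simpa using hs e x 1 h
  -- The lift of `x` with side `1` is paired with the lift of `σ x` with side `-1`.
  refine exists_isPairing_of_equiv (fun e =>
    { toFun := fun p => ⟨(σ e p.1.1, s e (σ e p.1.1) (-1)),
        (hσ e _ p.2.1 (hpos p.2.2)).2.1.1, sneg (hσ e _ p.2.1 (hpos p.2.2)).2.1.2⟩
      invFun := fun p => ⟨((σ e).symm p.1.1, s e ((σ e).symm p.1.1) 1),
        (hσ e _ p.2.1 (hneg p.2.2)).2.2.1, spos (hσ e _ p.2.1 (hneg p.2.2)).2.2.2⟩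
      left_inv := ?_
      right_inv := ?_ }) ?_
  · intro p
    refine Subtype.ext (eq_of_side_eq (e := e) (by simp) ?_ ?_)
    · simp only [Equiv.symm_apply_apply]
      rw [spos (hpos p.2.2), p.2.2]
    · simp only [Equiv.symm_apply_apply]
      rw [spos (hpos p.2.2)]
      norm_num
  · intro p
    refine Subtype.ext (eq_of_side_eq (e := e) (by simp) ?_ ?_)
    · simp only [Equiv.apply_symm_apply]
      rw [sneg (hneg p.2.2), p.2.2]
    · simp only [Equiv.apply_symm_apply]
      rw [sneg (hneg p.2.2)]
      norm_num
  · intro e p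
    exact (hσ e _ p.2.1 (hpos p.2.2)).1

-- The vanishing sum says that `S` has as many elements of side `1` as of side `-1`, so any
-- bijection between them will do: a pair with equal projections would consist of both lifts of one
-- variable, which `hS` forbids.
open Classical in
theorem exists_isPairing_of_sum_side [Fintype (coveringNetwork F₁ F₂).V]
    (hS : ∀ p ∈ S, (p.1, -p.2) ∉ S)
    (hsum : ∀ e : EqIndex T₁ T₂ Q, ∑ p : (coveringNetwork F₁ F₂).V with p ∈ S, side e p = 0) :
    ∃ τ : EqIndex T₁ T₂ Q → _, IsPairing S τ := by
  have hcard : ∀ e : EqIndex T₁ T₂ Q, Nonempty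
      ({p // p ∈ S ∧ side e p = 1} ≃ {p // p ∈ S ∧ side e p = -1}) := by
    intro e
    rw [← Fintype.card_eq, Fintype.card_subtype, Fintype.card_subtype, ← Finset.filter_filter,
      ← Finset.filter_filter, ← Int.natCast_inj, ← sub_eq_zero, ← hsum e, Finset.card_filter,
      Finset.card_filter, Nat.cast_sum, Nat.cast_sum, ← Finset.sum_sub_distrib]
    refine Finset.sum_congr rfl fun p _ => ?_
    rcases side_mem e p with h | h | h <;> simp [h]
  refine exists_isPairing_of_equiv (fun e => (hcard e).some) fun e p h => ?_
  set q := (hcard e).some p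
  have hq : q.1 = (p.1.1, -p.1.2) := by
    refine eq_of_side_eq (e := e) h ?_ (by rw [q.2.2]; norm_num)
    rw [side_neg, q.2.2, p.2.2]
  exact hS _ p.2.1 (hq ▸ q.2.1)

open Classical in
/-- The vertices of a solution that do not cancel again form a solution. -/
theorem sum_side_filter_not_mem [Fintype (coveringNetwork F₁ F₂).V] (e : EqIndex T₁ T₂ Q)
    (h : ∑ p : (coveringNetwork F₁ F₂).V with p ∈ S, side e p = 0) :
    ∑ p : (coveringNetwork F₁ F₂).V with p ∈ {p | p ∈ S ∧ (p.1, -p.2) ∉ S}, side e p = 0 := by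
  have hsplit := Finset.sum_filter_add_sum_filter_not
    (Finset.univ.filter fun p : (coveringNetwork F₁ F₂).V => p ∈ S)
    (fun p => (p.1, -p.2) ∈ S) (fun p => side e p)
  rw [h, Finset.filter_filter, Finset.filter_filter] at hsplit
  have hzero : ∑ p : (coveringNetwork F₁ F₂).V with p ∈ S ∧ (p.1, -p.2) ∈ S, side e p = 0 := by
    -- Vertices whose opposite is also in `S` cancel against it.
    refine Finset.sum_involution (fun p _ => (p.1, -p.2)) ?_ ?_ ?_ ?_
    · intro p _
      rw [side_neg, add_neg_cancel]
    · intro p _ _ h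
      exact units_ne_neg_self p.2 (congrArg Prod.snd h).symm
    · intro p hp
      simp only [Finset.mem_filter, Finset.mem_univ, true_and] at hp ⊢
      simpa using hp.symm
    · intro p _
      simp
  rw [hzero, zero_add] at hsplit
  simpa using hsplit

theorem exists_isGenGraphMap [IsTreeQuiver T₁] [IsTreeQuiver T₂] (hghost : GhostFree F₁ F₂)
    (A : Set (pullbackNetwork F₁ F₂).V) (hne : A.Nonempty)
    (hA : ∀ e : EqIndex T₁ T₂ Q, ∀ x ∈ A, sgn e x ≠ 0 → ∃ y ∈ A, y ≠ x ∧ sgn e y ≠ 0) :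
    ∃ G : (coveringNetwork F₁ F₂).Subnetwork, IsGenGraphMap G ∧ ∀ p ∈ G.verts, p.1 ∈ A := by
  classical
  have := Fintype.ofFinite (pullbackNetwork F₁ F₂).V
  obtain ⟨x, hx⟩ := hne
  obtain ⟨τ, hτ⟩ := exists_isPairing_preimage A hA
  have hx' : ((x, 1) : (coveringNetwork F₁ F₂).V) ∈
    {p : (coveringNetwork F₁ F₂).V | p.1 ∈ A} := hx
  have hO := hτ.isPairing_orbit hx'
  set M := orbit τ ((x, 1) : (coveringNetwork F₁ F₂).V)
  -- Otherwise the orbit would be involution-invariant, hence a ghost.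
  have hinv : ∃ p ∈ M, (p.1, -p.2) ∉ M := by
    by_contra! hinv
    refine hghost (pairingNetwork M τ) ⟨⟨(x, 1), Relation.ReflTransGen.refl⟩,
      hτ.connected_orbit hx', ?_, hO.isComplete, hO.isFreeOf⟩
    refine Set.Subset.antisymm (Set.subset_preimage_image _ _) ?_
    rintro ⟨y, j⟩ ⟨⟨z, i⟩, hz, hzy⟩
    obtain rfl : z = y := hzy
    rcases Int.units_eq_one_or j with rfl | rfl <;> rcases Int.units_eq_one_or i with rfl | rfl
    · exact hz
    · have := hinv _ hz
      rwa [neg_neg] at this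
    · exact hinv _ hz
    · exact hz
  obtain ⟨p, hp, hp'⟩ := hinv
  -- The old pairing need not preserve the set that is left after cancellation, so a new one is
  -- chosen by counting.
  obtain ⟨τ', hτ'⟩ := exists_isPairing_of_sum_side (S := {p | p ∈ M ∧ (p.1, -p.2) ∉ M})
    (fun p hp h => hp.2 h.1)
    (fun e => by
      convert sum_side_filter_not_mem (S := M) e (hO.isComplete.sum_side hO.isFreeOf e))
  have hp'' : p ∈ {p | p ∈ M ∧ (p.1, -p.2) ∉ M} := ⟨hp, hp'⟩
  have hO' := hτ'.isPairing_orbit hp''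
  refine ⟨pairingNetwork (orbit τ' p) τ', ⟨⟨p, Relation.ReflTransGen.refl⟩,
    hτ'.connected_orbit hp'', ?_, hO'.isComplete, hO'.isFreeOf⟩, ?_⟩
  · intro q hq hq'
    exact (hτ'.orbit_subset hp'' hq).2 (hτ'.orbit_subset hp'' hq').1
  · intro q hq
    exact hτ.orbit_subset hx' (hτ'.orbit_subset hp'' hq).1

end Existence
-- The solution space is spanned by generalised graph maps.
section Solutions

variable {T₁ T₂ Q : Type*} [Quiver T₁] [Quiver T₂] [Quiver Q] {F₁ : T₁ ⥤q Q} {F₂ : T₂ ⥤q Q}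
  {K : Type*} [Field K]

open Classical in
variable (K) in
/-- The matrix of the linear map given by a subnetwork. -/
noncomputable def networkVec (M : (coveringNetwork F₁ F₂).Subnetwork)
    (x : (pullbackNetwork F₁ F₂).V) : K :=
  ∑ j : ℤˣ, if ((x, j) : (coveringNetwork F₁ F₂).V) ∈ M.verts then ((j : ℤ) : K) else 0

/-- Only one of the two lifts contributes, so the entry is `±1` and in particular nonzero in `K`. -/
theorem IsInvolutionFree.networkVec_eq {M : (coveringNetwork F₁ F₂).Subnetwork}
    (hM : IsInvolutionFree M) {p : (coveringNetwork F₁ F₂).V} (hp : p ∈ M.verts) :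
    networkVec K M p.1 = ((p.2 : ℤ) : K) := by
  classical
  rw [networkVec, Finset.sum_eq_single p.2, if_pos hp]
  · intro j _ hj
    rw [if_neg]
    have := hM p hp
    rcases Int.units_eq_one_or j with rfl | rfl <;>
      rcases Int.units_eq_one_or p.2 with h | h <;> simp_all
  · exact fun h => absurd (Finset.mem_univ _) h

theorem networkVec_eq_zero {M : (coveringNetwork F₁ F₂).Subnetwork}
    {x : (pullbackNetwork F₁ F₂).V} (hx : ∀ p ∈ M.verts, p.1 ≠ x) : networkVec K M x = 0 :=
  Finset.sum_eq_zero fun _ _ => if_neg fun h => hx _ h rfl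

variable [Fintype (pullbackNetwork F₁ F₂).V]

variable (F₁ F₂ K) in
/-- The space of matrices that satisfy all the equations. -/
def solutions : Submodule K ((pullbackNetwork F₁ F₂).V → K) where
  carrier := {h | ∀ e : EqIndex T₁ T₂ Q, ∑ x, (sgn e x : K) * h x = 0}
  zero_mem' e := by simp
  add_mem' hf hg e := by simp [mul_add, Finset.sum_add_distrib, hf e, hg e]
  smul_mem' c f hf e := by
    have : ∀ x, (sgn e x : K) * (c • f) x = c * ((sgn e x : K) * f x) := fun x => by
      simp only [Pi.smul_apply, smul_eq_mul]
      ring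
    simp only [this, ← Finset.mul_sum, hf e, mul_zero]

theorem IsComplete.networkVec_mem [IsTreeQuiver T₁] {M : (coveringNetwork F₁ F₂).Subnetwork}
    (hM : IsComplete M) (hf : M.IsFreeOf (blocked₂ F₁ F₂)) :
    networkVec K M ∈ solutions F₁ F₂ K := by
  classical
  intro e
  have h := congrArg (Int.cast : ℤ → K) (hM.sum_side hf e)
  rw [Finset.sum_filter, Int.cast_sum, Int.cast_zero, Fintype.sum_prod_type] at h
  rw [← h]
  refine Finset.sum_congr rfl fun x _ => ?_
  rw [networkVec, Finset.mul_sum]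
  refine Finset.sum_congr rfl fun j _ => ?_
  split_ifs <;> simp [side]

theorem solutions_le_span [IsTreeQuiver T₁] [IsTreeQuiver T₂] (hghost : GhostFree F₁ F₂) :
    solutions F₁ F₂ K ≤ Submodule.span K
      {h | ∃ G : (coveringNetwork F₁ F₂).Subnetwork, IsGenGraphMap G ∧ networkVec K G = h} := by
  classical
  intro h hh
  induction hn : (Finset.univ.filter fun x => h x ≠ 0).card using Nat.strong_induction_on
    generalizing h with
  | _ n ih =>
    by_cases h0 : ∀ x, h x = 0
    · rw [show h = 0 from funext h0]
      exact Submodule.zero_mem _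
    push Not at h0
    obtain ⟨G, hG, hGA⟩ := exists_isGenGraphMap hghost {x | h x ≠ 0} h0 (by
      intro e x hx he
      -- If `x` were the only element of the support in `e`, the equation would reduce to `±h x =
      -- 0`.
      by_contra! hcon
      have := hh e
      rw [Finset.sum_eq_single x] at this
      · refine (mul_ne_zero ?_ hx) this
        rcases sgn_mem e x with h' | h' | h' <;> simp [h'] at he ⊢
      · intro y _ hyx
        by_cases hy : h y = 0
        · rw [hy, mul_zero]
        · rw [hcon y hy hyx, Int.cast_zero, zero_mul]
      · simp)
    obtain ⟨p, hp⟩ := hG.nonempty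
    have hpG := hG.involutionFree.networkVec_eq (K := K) hp
    have hne : ((p.2 : ℤ) : K) ≠ 0 := by
      rcases Int.units_eq_one_or p.2 with h' | h' <;> simp [h']
    -- This coefficient makes `h - c • networkVec K G` vanish at `p.1`. As `G` lies over the support
    -- of `h`, the support strictly shrinks.
    set c := h p.1 / ((p.2 : ℤ) : K)
    have hsol : h - c • networkVec K G ∈ solutions F₁ F₂ K :=
      Submodule.sub_mem _ hh (Submodule.smul_mem _ _ (hG.complete.networkVec_mem hG.free))
    have hlt : (Finset.univ.filter fun x => (h - c • networkVec K G) x ≠ 0).card < n := by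
      rw [← hn]
      refine Finset.card_lt_card (Finset.ssubset_iff_of_subset ?_ |>.2 ⟨p.1, ?_, ?_⟩)
      · intro x
        simp only [Finset.mem_filter, Finset.mem_univ, true_and]
        intro hx hx0
        refine hx ?_
        have : networkVec K G x = 0 := networkVec_eq_zero fun q hq hqx => hGA q hq (hqx ▸ hx0)
        simp [hx0, this]
      · simpa using hGA p hp
      · simp [hpG, c, hne]
    have hmem := ih _ hlt hsol rfl
    rw [← sub_add_cancel h (c • networkVec K G)]
    exact Submodule.add_mem _ hmem (Submodule.smul_mem _ _ (Submodule.subset_span ⟨G, hG, rfl⟩))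

end Solutions

/-! ### Comparison of the equations with the commutation relations. -/

section Sides

variable {T₁ T₂ Q : Type*} [Quiver T₁] [Quiver T₂] [Quiver Q] {F₁ : T₁ ⥤q Q} {F₂ : T₂ ⥤q Q}
  {K : Type*} [Field K]

/-- The arrows of a tree over an arrow of `Q`. -/
abbrev Fibre {T : Type*} [Quiver T] (F : T ⥤q Q) (γ : Quiver.Total Q) :=
  {a : Quiver.Total T // arrowMap F a = γ}

-- In a tree, an arrow is determined by its endpoints, so variables on the left correspond
-- bijectively to arrows above `γ` that start at `n`.
open Classical in
theorem sum_onLeft [IsTreeQuiver T₁] [Fintype (pullbackNetwork F₁ F₂).V]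
    (h : (pullbackNetwork F₁ F₂).V → K)
    {i j : Q} (γ : i ⟶ j) (n : T₁) (m : {m : T₂ // F₂.obj m = j})
    [Fintype (Fibre F₁ ⟨i, j, γ⟩)] :
    ∑ x with OnLeft ((⟨i, j, γ⟩, n, m.1) : EqIndex T₁ T₂ Q) x, h x =
      ∑ a : Fibre F₁ ⟨i, j, γ⟩ with a.1.left = n,
        h ⟨(a.1.right, m.1), (obj_right_of_arrowMap a.2).trans m.2.symm⟩ := by
  symm
  refine Finset.sum_bij
    (fun a _ => ⟨(a.1.right, m.1), (obj_right_of_arrowMap a.2).trans m.2.symm⟩) ?_ ?_ ?_ ?_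
  · intro a ha
    simp only [Finset.mem_filter, Finset.mem_univ, true_and] at ha ⊢
    exact ⟨rfl, a.1, ha, rfl, a.2⟩
  · intro a ha b hb hab
    simp only [Finset.mem_filter, Finset.mem_univ, true_and] at ha hb
    exact Subtype.ext (total_ext (ha.trans hb.symm) (congrArg (fun x => x.1.1) hab))
  · intro x hx
    simp only [Finset.mem_filter, Finset.mem_univ, true_and] at hx
    obtain ⟨h1, a, h2, h3, h4⟩ := hx
    exact ⟨⟨a, h4⟩, by simpa using h2, Subtype.ext (Prod.ext h3 h1.symm)⟩
  · intro a _
    rfl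

open Classical in
theorem sum_onRight [IsTreeQuiver T₂] [Fintype (pullbackNetwork F₁ F₂).V]
    (h : (pullbackNetwork F₁ F₂).V → K)
    {i j : Q} (γ : i ⟶ j) (n : {n : T₁ // F₁.obj n = i}) (m : T₂)
    [Fintype (Fibre F₂ ⟨i, j, γ⟩)] :
    ∑ x with OnRight ((⟨i, j, γ⟩, n.1, m) : EqIndex T₁ T₂ Q) x, h x =
      ∑ b : Fibre F₂ ⟨i, j, γ⟩ with b.1.right = m,
        h ⟨(n.1, b.1.left), n.2.trans (obj_left_of_arrowMap b.2).symm⟩ := by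
  symm
  refine Finset.sum_bij
    (fun b _ => ⟨(n.1, b.1.left), n.2.trans (obj_left_of_arrowMap b.2).symm⟩) ?_ ?_ ?_ ?_
  · intro b hb
    simp only [Finset.mem_filter, Finset.mem_univ, true_and] at hb ⊢
    exact ⟨rfl, b.1, rfl, hb, b.2⟩
  · intro a ha b hb hab
    simp only [Finset.mem_filter, Finset.mem_univ, true_and] at ha hb
    exact Subtype.ext (total_ext (congrArg (fun x => x.1.2) hab) (ha.trans hb.symm))
  · intro x hx
    simp only [Finset.mem_filter, Finset.mem_univ, true_and] at hx
    obtain ⟨h1, b, h2, h3, h4⟩ := hx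
    exact ⟨⟨b, h4⟩, by simpa using h3, Subtype.ext (Prod.ext h1.symm h2)⟩
  · intro b _
    rfl

open Classical in
theorem sum_sgn_mul [IsTreeQuiver T₁] [Fintype (pullbackNetwork F₁ F₂).V]
    (h : (pullbackNetwork F₁ F₂).V → K)
    (e : EqIndex T₁ T₂ Q) :
    ∑ x, (sgn e x : K) * h x = ∑ x with OnLeft e x, h x - ∑ x with OnRight e x, h x := by
  rw [Finset.sum_filter, Finset.sum_filter, ← Finset.sum_sub_distrib]
  refine Finset.sum_congr rfl fun x _ => ?_
  by_cases hl : OnLeft e x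
  · rw [if_pos hl, if_neg hl.not_onRight, hl.sgn_eq, Int.cast_one, one_mul, sub_zero]
  · by_cases hr : OnRight e x
    · rw [if_neg hl, if_pos hr, hr.sgn_eq]
      push_cast
      ring
    · rw [if_neg hl, if_neg hr, sgn, if_neg hl, if_neg hr]
      simp

end Sides

section Matrices

variable {T₁ T₂ Q : Type*} [Quiver T₁] [Quiver T₂] [Quiver Q] {F₁ : T₁ ⥤q Q} {F₂ : T₂ ⥤q Q}
  {K : Type*} [Field K] [IsTreeQuiver T₁] [IsTreeQuiver T₂]
  {ρ : ∀ i j : Q, Set (Quiver.Path i j)} {hF₁ : IsBoundMorphism ρ F₁}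
  {hF₂ : IsBoundMorphism ρ F₂}

variable (hF₁ hF₂) in
/-- The matrix of a family of linear maps with respect to the canonical bases. -/
noncomputable def matrixOf :
    (∀ i : Q, (genTreeModule K ρ F₁ hF₁).obj i →ₗ[K] (genTreeModule K ρ F₂ hF₂).obj i) →ₗ[K]
      ((pullbackNetwork F₁ F₂).V → K) where
  toFun f x := DirectSum.component K {m : T₂ // F₂.obj m = F₁.obj x.1.1} (fun _ => K)
    ⟨x.1.2, x.2.symm⟩ (f (F₁.obj x.1.1) (basisVec K ρ F₁ hF₁ ⟨x.1.1, rfl⟩))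
  map_add' f g := by
    funext x
    simp only [Pi.add_apply, LinearMap.add_apply, map_add]
  map_smul' c f := by
    funext x
    simp only [Pi.smul_apply, LinearMap.smul_apply, map_smul, RingHom.id_apply]

theorem matrixOf_apply
    (f : ∀ i : Q, (genTreeModule K ρ F₁ hF₁).obj i →ₗ[K] (genTreeModule K ρ F₂ hF₂).obj i)
    {i : Q} (n : {n : T₁ // F₁.obj n = i}) (m : {m : T₂ // F₂.obj m = i}) :
    DirectSum.component K {m : T₂ // F₂.obj m = i} (fun _ => K) m
      (f i (basisVec K ρ F₁ hF₁ n)) =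
      matrixOf hF₁ hF₂ f ⟨(n.1, m.1), n.2.trans m.2.symm⟩ := by
  obtain ⟨n, rfl⟩ := n
  rfl

theorem genTreeModule_linearMap_ext {i : Q} {N : Type*} [AddCommGroup N] [Module K N]
    {f g : (genTreeModule K ρ F₁ hF₁).obj i →ₗ[K] N}
    (h : ∀ n, f (basisVec K ρ F₁ hF₁ n) = g (basisVec K ρ F₁ hF₁ n)) : f = g := by
  classical
  refine DirectSum.linearMap_ext _ fun n => LinearMap.ext_ring ?_
  exact h n

theorem genTreeModule_ext {i : Q} {x y : (genTreeModule K ρ F₁ hF₁).obj i}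
    (h : ∀ n, DirectSum.component K {n : T₁ // F₁.obj n = i} (fun _ => K) n x =
      DirectSum.component K {n : T₁ // F₁.obj n = i} (fun _ => K) n y) : x = y :=
  DirectSum.ext_component K h

theorem matrixOf_injective : Function.Injective (matrixOf (K := K) hF₁ hF₂) := by
  intro f g h
  funext i
  refine genTreeModule_linearMap_ext fun n => genTreeModule_ext fun m => ?_
  rw [matrixOf_apply, matrixOf_apply, h]

open Classical in
theorem component_basisVec {i : Q} (n n' : {n : T₁ // F₁.obj n = i}) :
    DirectSum.component K {n : T₁ // F₁.obj n = i} (fun _ => K) n (basisVec K ρ F₁ hF₁ n') =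
      if n' = n then 1 else 0 := by
  rw [basisVec, DirectSum.component.of]
  split_ifs with h
  · subst h; rfl
  · rfl

open Classical in
theorem matrixOf_networkMap (M : (coveringNetwork F₁ F₂).Subnetwork) :
    matrixOf hF₁ hF₂ (networkMap K ρ hF₁ hF₂ M) = networkVec K M := by
  funext ⟨⟨n, m⟩, hnm⟩
  have := Fintype.ofFinite {m : T₂ // F₂.obj m = F₁.obj n}
  change DirectSum.component K {m : T₂ // F₂.obj m = F₁.obj n} (fun _ => K) ⟨m, hnm.symm⟩
    (networkMap K ρ hF₁ hF₂ M (F₁.obj n) (basisVec K ρ F₁ hF₁ ⟨n, rfl⟩)) = _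
  rw [networkMap, basisVec, DirectSum.toModule_lof, LinearMap.toSpanSingleton_apply, one_smul,
    finsum_eq_sum_of_fintype, map_sum, Fintype.sum_prod_type,
    Finset.sum_eq_single ⟨m, hnm.symm⟩]
  · refine Finset.sum_congr rfl fun j _ => ?_
    split_ifs
    · rw [map_smul, component_basisVec, if_pos rfl, smul_eq_mul, mul_one]
    · rw [map_zero]
  · intro m' _ hm'
    refine Finset.sum_eq_zero fun j _ => ?_
    split_ifs
    · rw [map_smul, component_basisVec, if_neg hm', smul_zero]
    · rw [map_zero]
  · exact fun h => absurd (Finset.mem_univ _) h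

open Classical in
theorem map_basisVec {i j : Q} (γ : i ⟶ j) (n : {n : T₁ // F₁.obj n = i})
    [Fintype (Fibre F₁ ⟨i, j, γ⟩)] :
    (genTreeModule K ρ F₁ hF₁).map γ (basisVec K ρ F₁ hF₁ n) =
      ∑ a : Fibre F₁ ⟨i, j, γ⟩, if a.1.left = n.1 then
        basisVec K ρ F₁ hF₁ ⟨a.1.right, obj_right_of_arrowMap a.2⟩ else 0 := by
  change pushDownMap F₁ (constRep K T₁) γ (basisVec K ρ F₁ hF₁ n) = _
  rw [pushDownMap, finsum_eq_sum_of_fintype, LinearMap.sum_apply]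
  refine Finset.sum_congr rfl fun a _ => ?_
  rw [LinearMap.comp_apply, LinearMap.comp_apply, LinearMap.id_apply]
  erw [component_basisVec]
  split_ifs with h1 h2 h2
  · rfl
  · exact absurd (congrArg Subtype.val h1).symm h2
  · exact absurd (Subtype.ext h2.symm) h1
  · rw [map_zero]

open Classical in
theorem component_map {i j : Q} (γ : i ⟶ j) (m : {m : T₂ // F₂.obj m = j})
    [Fintype (Fibre F₂ ⟨i, j, γ⟩)] (y : (genTreeModule K ρ F₂ hF₂).obj i) :
    DirectSum.component K {m : T₂ // F₂.obj m = j} (fun _ => K) m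
      ((genTreeModule K ρ F₂ hF₂).map γ y) =
      ∑ b : Fibre F₂ ⟨i, j, γ⟩, if b.1.right = m.1 then
        DirectSum.component K {m : T₂ // F₂.obj m = i} (fun _ => K)
          ⟨b.1.left, obj_left_of_arrowMap b.2⟩ y else 0 := by
  change DirectSum.component K {m : T₂ // F₂.obj m = j} (fun _ => K) m
      (pushDownMap F₂ (constRep K T₂) γ y) = _
  rw [pushDownMap, finsum_eq_sum_of_fintype, LinearMap.sum_apply, map_sum]
  refine Finset.sum_congr rfl fun b _ => ?_
  rw [LinearMap.comp_apply, LinearMap.comp_apply, LinearMap.id_apply]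
  erw [DirectSum.component.of]
  obtain ⟨m, hm⟩ := m
  split_ifs with h1 h2 h2
  · obtain rfl := congrArg Subtype.val h1
    rfl
  · exact absurd (congrArg Subtype.val h1) h2
  · exact absurd (Subtype.ext h2) h1
  · rfl

/-- The equation `(γ, n, m)` is the `m`-th coordinate of the commutation relation for `γ` at the
basis vector of `n`. -/
theorem component_commutator [Fintype (pullbackNetwork F₁ F₂).V]
    (f : ∀ i : Q, (genTreeModule K ρ F₁ hF₁).obj i →ₗ[K] (genTreeModule K ρ F₂ hF₂).obj i)
    {i j : Q} (γ : i ⟶ j) (n : {n : T₁ // F₁.obj n = i}) (m : {m : T₂ // F₂.obj m = j}) :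
    DirectSum.component K {m : T₂ // F₂.obj m = j} (fun _ => K) m
        (f j ((genTreeModule K ρ F₁ hF₁).map γ (basisVec K ρ F₁ hF₁ n))) -
      DirectSum.component K {m : T₂ // F₂.obj m = j} (fun _ => K) m
        ((genTreeModule K ρ F₂ hF₂).map γ (f i (basisVec K ρ F₁ hF₁ n))) =
      ∑ x, (sgn ((⟨i, j, γ⟩, n.1, m.1) : EqIndex T₁ T₂ Q) x : K) * matrixOf hF₁ hF₂ f x := by
  classical
  have := Fintype.ofFinite (Fibre F₁ ⟨i, j, γ⟩)
  have := Fintype.ofFinite (Fibre F₂ ⟨i, j, γ⟩)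
  rw [sum_sgn_mul, sum_onLeft, sum_onRight, map_basisVec, component_map, map_sum, map_sum,
    Finset.sum_filter, Finset.sum_filter]
  congr 1
  · refine Finset.sum_congr rfl fun a _ => ?_
    split_ifs
    · rw [matrixOf_apply]
    · rw [map_zero, map_zero]
  · refine Finset.sum_congr rfl fun b _ => ?_
    rw [matrixOf_apply]

theorem mem_homSpace_iff [Fintype (pullbackNetwork F₁ F₂).V]
    (f : ∀ i : Q, (genTreeModule K ρ F₁ hF₁).obj i →ₗ[K] (genTreeModule K ρ F₂ hF₂).obj i) :
    f ∈ HomSpace (genTreeModule K ρ F₁ hF₁) (genTreeModule K ρ F₂ hF₂) ↔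
      matrixOf hF₁ hF₂ f ∈ solutions F₁ F₂ K := by
  constructor
  · rintro hf ⟨⟨i, j, γ⟩, n, m⟩
    by_cases hnm : F₁.obj n = i ∧ F₂.obj m = j
    · rw [← component_commutator f γ ⟨n, hnm.1⟩ ⟨m, hnm.2⟩, hf i j γ, sub_self]
    -- If `n`, `m` do not lie above the endpoints of `γ`, no variable occurs and the equation is
    -- trivial.
    · refine Finset.sum_eq_zero fun x _ => ?_
      have : sgn ((⟨i, j, γ⟩, n, m) : EqIndex T₁ T₂ Q) x = 0 := by
        by_contra h0
        refine hnm ?_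
        rcases onLeft_or_onRight h0 with ⟨h1, a, h2, h3, h4⟩ | ⟨h1, b, h2, h3, h4⟩
        · refine ⟨?_, ?_⟩
          · exact (congrArg F₁.obj h2).symm.trans (obj_left_of_arrowMap h4)
          · have := obj_right_of_arrowMap h4
            simp only at h1 this
            rw [← this, ← h1, h3, x.2]
        · refine ⟨?_, ?_⟩
          · have := obj_left_of_arrowMap h4
            simp only at h1 this
            rw [← this, ← h1, h2, x.2]
          · exact (congrArg F₂.obj h3).symm.trans (obj_right_of_arrowMap h4)
      rw [this, Int.cast_zero, zero_mul]
  · intro hf i j γ x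
    have : (f j).comp ((genTreeModule K ρ F₁ hF₁).map γ) =
        ((genTreeModule K ρ F₂ hF₂).map γ).comp (f i) := by
      refine genTreeModule_linearMap_ext fun n => genTreeModule_ext fun m => ?_
      rw [← sub_eq_zero]
      exact (component_commutator f γ n m).trans (hf _)
    exact LinearMap.congr_fun this x

end Matrices

end GTM

/-! ### The theorem, transported from matrices to homomorphisms. -/

open GTM in
theorem theoremA {K : Type*} [Field K] (hK : ringChar K ≠ 2)
    {Q : Type*} [Quiver Q] (ρ : ∀ i j : Q, Set (Quiver.Path i j)) (hρ : IsLocallyBound ρ)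
    {T₁ : Type*} [Quiver T₁] [IsTreeQuiver T₁] {T₂ : Type*} [Quiver T₂] [IsTreeQuiver T₂]
    (F₁ : T₁ ⥤q Q) (hF₁ : IsBoundMorphism ρ F₁)
    (F₂ : T₂ ⥤q Q) (hF₂ : IsBoundMorphism ρ F₂)
    (hghost : GhostFree F₁ F₂) :
    (∀ G : (coveringNetwork F₁ F₂).Subnetwork, IsGenGraphMap G →
      networkMap K ρ hF₁ hF₂ G ∈
        HomSpace (genTreeModule K ρ F₁ hF₁) (genTreeModule K ρ F₂ hF₂)) ∧
    ∀ H ∈ HomSpace (genTreeModule K ρ F₁ hF₁) (genTreeModule K ρ F₂ hF₂),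
      ∃ (N : ℕ) (μ : Fin N → K) (G : Fin N → (coveringNetwork F₁ F₂).Subnetwork),
        (∀ l, IsGenGraphMap (G l)) ∧
        H = ∑ l, μ l • networkMap K ρ hF₁ hF₂ (G l) := by
  have := Fintype.ofFinite (pullbackNetwork F₁ F₂).V
  refine ⟨fun G hG => ?_, fun H hH => ?_⟩
  · rw [mem_homSpace_iff, matrixOf_networkMap]
    exact hG.complete.networkVec_mem hG.free
  · obtain ⟨N, μ, v, hv⟩ := (Submodule.mem_span_set').1
      (solutions_le_span hghost ((mem_homSpace_iff H).1 hH))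
    choose G hG hGv using fun l => (v l).2
    refine ⟨N, μ, G, hG, matrixOf_injective (hF₁ := hF₁) (hF₂ := hF₂) ?_⟩
    rw [map_sum, ← hv]
    refine Finset.sum_congr rfl fun l _ => ?_
    rw [map_smul, matrixOf_networkMap, hGv]
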